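/- Let $d\ge 1$, let $\Sigma_0\in\mathbb{R}^{d\times d}$ be symmetric positive definite, $\mu_0\in\mathbb{R}^d$ and $\sigma>0$. A customer's ideal point is $\theta\sim\mathcal N(\mu_0,\Sigma_0)$. In rounds $t=1,2,\dots$ an agent chooses a unit vector $y_t\in\mathbb{R}^d$ as a measurable function of the earlier queries and responses (a policy) and observes $z_t=\theta^\top y_t+\epsilon_t$, where the $\epsilon_t\sim\mathcal N(0,\sigma^2)$ are i.i.d. and independent of $\theta$. Let $\mathcal H_m=(y_1,z_1,\dots,y_m,z_m)$, let $\Sigma_m$ be the covariance matrix of the conditional distribution of $\theta$ given $\mathcal H_m$, and for $k\ge1$ put $$V_k^*=\sup_{S\subset\mathbb{R}^d,\ |S|=k}\ \mathbb{E}\Bigl[\max_{x\in S}\bigl(-\tfrac12\|x-\theta\|_2^2\bigr)\,\Big|\,\mathcal H_m\Bigr],\qquad V_\infty^*=\lim_{k\to\infty}V_k^* .$$ Rank-capped water-filling with $m$ questions means the following. Let $v_1,\dots,v_d$ be an orthonormal eigenbasis of $\Sigma_0$ with eigenvalues $\lambda_1\ge\dots\ge\lambda_d>0$, and let $r\le\min\{m,d\}$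 and $\lambda^\star>0$ satisfy $r/\lambda^\star=\sum_{i\le r}1/\lambda_i+m/\sigma^2$, $\lambda^\star<\lambda_i$ for $i\le r$, and, if $r<\min\{m,d\}$, $\lambda^\star\ge\lambda_i$ for $i>r$. The policy is rank-capped water-filling if its queries always satisfy $\bigl(\Sigma_0^{-1}+\sigma^{-2}\sum_{t\le m}y_ty_t^\top\bigr)v_i=(\lambda_i^\star)^{-1}v_i$ for all $i$, where $\lambda_i^\star=\lambda^\star$ for $i\le r$ and $\lambda_i^\star=\lambda_i$ for $i>r$. Let $\bar m=\sigma^2\bigl(d/\lambda_{\min}(\Sigma_0)-\operatorname{tr}(\Sigma_0^{-1})\bigr)^+$. (i) For every policy and every $m\ge0$, almost surely the limit $V_\infty^*$ exists and $$V_\infty^*-V_1^*=\tfrac12\operatorname{tr}(\Sigma_m)\ \ge\ \frac{d^2}{2\bigl(\operatorname{tr}(\Sigma_0^{-1})+m/\sigma^2\bigr)} .$$ If $m\ge\max\{d,\bar m\}$, then a rank-capped water-filling policy exists, and under every such policy $V_\infty^*-V_1^*$ almost surely equals this lower bound. (ii) Let $\varepsilon>0$. Under every policy and for every $m$, almost surely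 $V_\infty^*-V_1^*\le\varepsilon$ only if $m\ge\sigma^2\bigl(\tfrac{d^2}{2\varepsilon}-\operatorname{tr}(\Sigma_0^{-1})\bigr)^+$. Let $m(\varepsilon)$ be the least $m$ for which some policy achieves $V_\infty^*-V_1^*\le\varepsilon$ almost surely, and $m_{\mathrm{wf}}(\varepsilon)$ the least $m$ for which some rank-capped water-filling policy with $m$ questions does. For fixed $\Sigma_0$ and $\sigma$, both are $\Theta(d^2\sigma^2/\varepsilon)$ as $\varepsilon\downarrow0$, with absolute constants: for all sufficiently small $\varepsilon>0$, $$\frac{d^2\sigma^2}{4\varepsilon}\le m(\varepsilon)\le m_{\mathrm{wf}}(\varepsilon)\le\frac{d^2\sigma^2}{\varepsilon} .$$ Without solicitation ($m=0$), for every $k\ge1$, $V_\infty^*-V_k^*\le\varepsilon$ only if $$k\ \ge\ \left(\frac{d(\det\Sigma_0)^{1/d}}{2\varepsilon}\right)^{d/2},$$ and hence the least $k\ge1$ with $V_\infty^*-V_k^*\le\varepsilon$ is $\Omega(\varepsilon^{-d/2})$ as $\varepsilon\downarrow0$ for fixed $\Sigma_0$. -/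

import Mathlib

open MeasureTheory ProbabilityTheory Filter Asymptotics
open scoped Topology

namespace SolicitThenSuggest

/-- The feature space `ℝ^d` with the Euclidean norm. -/
abbrev Feature (d : ℕ) : Type := EuclideanSpace ℝ (Fin d)

/-- A transcript `(y_1, z_1, …, y_t, z_t)` of queries and responses. The prior parameters are fixed
and therefore not recorded. -/
abbrev History (d t : ℕ) : Type := Fin t → Feature d × ℝ

/-- An adaptive solicitation policy: in each round the transcript so far is mapped (measurably) to a
unit query direction. Rounds are `0, 1, 2, …`; with a budget of `m` questions only the rounds
`0, …, m - 1` are used. -/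
structure Policy (d : ℕ) where
  query : (t : ℕ) → History d t → Feature d
  measurable_query : ∀ t, Measurable (query t)
  norm_query : ∀ t h, ‖query t h‖ = 1

/-- The transcript after `t` rounds when the customer's ideal point is `x` and the noise terms are
`e 0, e 1, …`: the response to the query `y` in round `t` is `z = ⟨x, y⟩ + e t`. -/
noncomputable def history {d : ℕ} (π : Policy d) (x : Feature d) (e : ℕ → ℝ) :
    (t : ℕ) → History d t
  | 0 => Fin.elim0
  | t + 1 =>
      Fin.snoc (α := fun _ => Feature d × ℝ) (history π x e t)
        (π.query t (history π x e t), inner ℝ x (π.query t (history π x e t)) + e t)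

/-- The Gaussian model: the ideal point `θ` is `N(μ₀, S₀)`, the noise terms are i.i.d. `N(0, σ²)`,
and the noise is independent of `θ`. -/
structure IsGaussianModel {Ω : Type*} [MeasurableSpace Ω] {d : ℕ} (μ₀ : Feature d)
    (S₀ : Matrix (Fin d) (Fin d) ℝ) (σ : ℝ) (P : Measure Ω) (θ : Ω → Feature d)
    (noise : ℕ → Ω → ℝ) : Prop where
  measurable_ideal : Measurable θ
  measurable_noise : ∀ t, Measurable (noise t)
  law_ideal : P.map θ = multivariateGaussian μ₀ S₀
  law_noise : ∀ t, P.map (noise t) = gaussianReal 0 (Real.toNNReal (σ ^ 2))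
  indep_noise : iIndepFun noise P
  indep_ideal_noise : IndepFun θ (fun ω t => noise t ω) P

section Model

variable {Ω : Type*} [MeasurableSpace Ω] {d : ℕ}

/-- The random transcript after `m` rounds under the policy `π`. -/
noncomputable def randomHistory (θ : Ω → Feature d) (noise : ℕ → Ω → ℝ) (π : Policy d) (m : ℕ)
    (ω : Ω) : History d m :=
  history π (θ ω) (fun t => noise t ω) m

/-- The posterior: the (regular) conditional distribution of the ideal point given the transcript
of the first `m` rounds under `π`. -/
noncomputable def posterior (P : Measure Ω) [IsProbabilityMeasure P] (θ : Ω → Feature d)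
    (noise : ℕ → Ω → ℝ) (π : Policy d) (m : ℕ) : Kernel (History d m) (Feature d) :=
  condDistrib θ (randomHistory θ noise π m) P

/-- The posterior after `m` rounds, along the realization `ω`. -/
noncomputable def posteriorAt (P : Measure Ω) [IsProbabilityMeasure P] (θ : Ω → Feature d)
    (noise : ℕ → Ω → ℝ) (π : Policy d) (m : ℕ) (ω : Ω) : Measure (Feature d) :=
  posterior P θ noise π m (randomHistory θ noise π m ω)

end Model

section Value

variable {d : ℕ}

/-- Customer utility `U(θ, x) = -½ ‖x - θ‖²`. -/
noncomputable def utility (t x : Feature d) : ℝ := -(1 / 2) * ‖x - t‖ ^ 2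

/-- `V(S; θ) = max_{x ∈ S} U(θ, x)`: the customer picks the best product of the assortment. -/
noncomputable def assortmentUtility (S : Finset (Feature d)) (t : Feature d) : ℝ :=
  ⨆ x : S, utility t x

/-- `V_k^*` under the belief `ν`: the optimal expected utility over assortments of `k` products. -/
noncomputable def optimalValue (ν : Measure (Feature d)) (k : ℕ) : ℝ :=
  ⨆ S : {S : Finset (Feature d) // S.card = k}, ∫ t, assortmentUtility S.1 t ∂ν

/-- `V_∞^* = lim_{k → ∞} V_k^*` under the belief `ν`. -/
noncomputable def limitValue (ν : Measure (Feature d)) : ℝ :=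
  limUnder atTop (fun k : ℕ => optimalValue ν k)

/-- The covariance matrix of the belief `ν`. -/
noncomputable def covMatrix (ν : Measure (Feature d)) : Matrix (Fin d) (Fin d) ℝ :=
  Matrix.of fun i j => covariance (fun x : Feature d => x i) (fun x : Feature d => x j) ν

end Value

section WaterFilling

variable {d : ℕ}

/-- The aggregate information matrix `M_m = ∑_t y_t y_tᵀ` of a transcript. -/
noncomputable def infoMatrix {m : ℕ} (h : History d m) : Matrix (Fin d) (Fin d) ℝ :=
  ∑ t, Matrix.vecMulVec (h t).1.ofLp (h t).1.ofLp

/-- Rank-capped water-filling with a budget of `m` questions: in an eigenbasis `v` of `S₀` with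
eigenvalues `lam 0 ≥ lam 1 ≥ …`, the `m` queries (whatever the responses) have an aggregate
information matrix for which `(S₀⁻¹ + M_m / σ²)⁻¹` is diagonal in the basis `v`, with the common
eigenvalue `level` in the first `r` directions and the prior eigenvalues in all others. Here
`r ≤ min m d` and `level` are pinned down by the precision budget and the threshold conditions. -/
def IsWaterFilling (S₀ : Matrix (Fin d) (Fin d) ℝ) (σ : ℝ) (m : ℕ) (π : Policy d) : Prop :=
  ∃ (v : OrthonormalBasis (Fin d) ℝ (Feature d)) (lam : Fin d → ℝ) (r : ℕ) (level : ℝ),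
    Antitone lam ∧
    (∀ i, S₀.mulVec (v i).ofLp = lam i • (v i).ofLp) ∧
    r ≤ min m d ∧
    0 < level ∧
    (r : ℝ) / level = (∑ i : Fin d with i.val < r, 1 / lam i) + (m : ℝ) / σ ^ 2 ∧
    (∀ i : Fin d, i.val < r → level < lam i) ∧
    (r < min m d → ∀ i : Fin d, r ≤ i.val → lam i ≤ level) ∧
    ∀ (x : Feature d) (e : ℕ → ℝ) (i : Fin d),
      (S₀⁻¹ + (1 / σ ^ 2) • infoMatrix (history π x e m)).mulVec (v i).ofLp =
        (1 / (if i.val < r then level else lam i)) • (v i).ofLp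

/-- The smallest eigenvalue of `S₀`. -/
noncomputable def minEigenvalue (S₀ : Matrix (Fin d) (Fin d) ℝ) : ℝ := sInf (spectrum ℝ S₀)

/-- The activation threshold `m̄ = σ² (d / λ_min(S₀) - tr(S₀⁻¹))⁺`. -/
noncomputable def activationThreshold (S₀ : Matrix (Fin d) (Fin d) ℝ) (σ : ℝ) : ℝ :=
  σ ^ 2 * max ((d : ℝ) / minEigenvalue S₀ - S₀⁻¹.trace) 0

end WaterFilling

section Requirements

variable {Ω : Type*} [MeasurableSpace Ω] {d : ℕ}

/-- The smallest number `m` of questions with which some policy of the class `C m` brings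
`V_∞^* - V_1^*` down to at most `δ` (almost surely). -/
noncomputable def questionsNeeded (P : Measure Ω) [IsProbabilityMeasure P] (θ : Ω → Feature d)
    (noise : ℕ → Ω → ℝ) (C : ℕ → Policy d → Prop) (δ : ℝ) : ℕ :=
  sInf {m : ℕ | ∃ π : Policy d, C m π ∧ ∀ᵐ ω ∂P,
    limitValue (posteriorAt P θ noise π m ω) - optimalValue (posteriorAt P θ noise π m ω) 1 ≤ δ}

/-- The smallest number `k ≥ 1` of products for which `V_∞^* - V_k^* ≤ δ` without any question. (No
query has been made after `0` rounds, so the policy `π` plays no role.) -/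
noncomputable def productsNeeded (P : Measure Ω) [IsProbabilityMeasure P] (θ : Ω → Feature d)
    (noise : ℕ → Ω → ℝ) (π : Policy d) (δ : ℝ) : ℕ :=
  sInf {k : ℕ | 1 ≤ k ∧ ∀ᵐ ω ∂P,
    limitValue (posteriorAt P θ noise π 0 ω) - optimalValue (posteriorAt P θ noise π 0 ω) k ≤ δ}

end Requirements

end SolicitThenSuggest

open SolicitThenSuggest

/-!
Only two features of the posterior matter: it has finite second moments, and its covariance is
known. For any belief with finite second moments, a single product is best placed at the mean and
loses half the trace of the covariance (`optimalValue_one`), while assortments exhausting a dense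
set lose nothing in the limit (`tendsto_optimalValue`). So the gap is half the trace of the
posterior covariance.

Adaptivity does not affect the covariance formula. Since each query is a function of the earlier
transcript, the joint law of ideal point and transcript has density
`exp (∑ t, (z_t ⟨x, y_t⟩ - ⟨x, y_t⟩² / 2) / σ²)` with respect to the product of the prior and the
law of a transcript of pure noise (`lintegral_ideal_history`). For a fixed transcript this is the
exponential of a quadratic polynomial in `x`, so completing the square
(`multivariateGaussian_withDensity_exp`) shows that the posterior is Gaussian with precision
`Λ = S₀⁻¹ + σ⁻² ∑ t, y_t y_tᵀ` (`posteriorAt_eq_multivariateGaussian`).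

Unit queries fix `tr Λ = tr S₀⁻¹ + m / σ²`, and Cauchy–Schwarz for the eigenvalues gives
`d² ≤ tr Λ⁻¹ · tr Λ`, with equality when `Λ` is scalar. Past the activation threshold `Λ` is scalar
under every water-filling policy (`trace_inv_precision_of_isWaterFilling`). Such a policy exists
because a positive matrix of trace `m` and rank at most `m` is a sum of `m` terms `y yᵀ` with unit
vectors `y` (`exists_unit_frame`).

The bound on the number of products is Shannon's lower bound on quantization error: the relative
entropy of a Gaussian law with respect to a mixture of `k` isotropic Gaussians centred at the
products is nonnegative, and the right choice of their variance turns this into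
`d (det S₀)^(1/d) k^(-2/d) / 2` as a lower bound for the gap (`integral_assortmentUtility_le`).
-/

namespace SolicitThenSuggest

/-! ### Value of assortments -/

section ValueTheory

variable {d : ℕ}

lemma utility_nonpos (t x : Feature d) : utility t x ≤ 0 := by
  unfold utility; nlinarith [sq_nonneg ‖x - t‖]

lemma measurable_utility (x : Feature d) : Measurable fun t => utility t x := by
  unfold utility; fun_prop

lemma utility_le_assortmentUtility {S : Finset (Feature d)} {x : Feature d} (hx : x ∈ S)
    (t : Feature d) : utility t x ≤ assortmentUtility S t :=
  le_ciSup (f := fun x : S => utility t x) (Set.finite_range _).bddAbove ⟨x, hx⟩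

lemma assortmentUtility_nonpos (S : Finset (Feature d)) (t : Feature d) :
    assortmentUtility S t ≤ 0 :=
  Real.iSup_le (fun x => utility_nonpos t x) le_rfl

lemma exists_assortmentUtility_eq {S : Finset (Feature d)} (hS : S.Nonempty) (t : Feature d) :
    ∃ x ∈ S, assortmentUtility S t = utility t x := by
  have : Nonempty S := hS.to_subtype
  obtain ⟨x, hx⟩ := exists_eq_ciSup_of_finite (f := fun x : S => utility t x)
  exact ⟨x, x.2, hx.symm⟩

lemma assortmentUtility_mono {S S' : Finset (Feature d)} (hS : S.Nonempty) (h : S ⊆ S')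
    (t : Feature d) : assortmentUtility S t ≤ assortmentUtility S' t := by
  obtain ⟨x, hx, he⟩ := exists_assortmentUtility_eq hS t
  exact he ▸ utility_le_assortmentUtility (h hx) t

lemma assortmentUtility_singleton (x t : Feature d) :
    assortmentUtility {x} t = utility t x := by
  obtain ⟨y, hy, he⟩ := exists_assortmentUtility_eq (Finset.singleton_nonempty x) t
  rw [he, Finset.mem_singleton.1 hy]

lemma measurable_assortmentUtility (S : Finset (Feature d)) :
    Measurable (assortmentUtility S) := by
  unfold assortmentUtility
  exact Measurable.iSup fun x : S => measurable_utility x.1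

lemma bddAbove_integral_assortmentUtility (ν : Measure (Feature d)) (k : ℕ) :
    BddAbove (Set.range fun S : {S : Finset (Feature d) // S.card = k} =>
      ∫ t, assortmentUtility S.1 t ∂ν) :=
  ⟨0, by rintro _ ⟨S, rfl⟩; exact integral_nonpos fun t => assortmentUtility_nonpos _ t⟩

lemma integral_le_optimalValue (ν : Measure (Feature d)) (S : Finset (Feature d)) :
    ∫ t, assortmentUtility S t ∂ν ≤ optimalValue ν S.card :=
  le_ciSup (bddAbove_integral_assortmentUtility ν S.card) ⟨S, rfl⟩

lemma optimalValue_nonpos (ν : Measure (Feature d)) (k : ℕ) : optimalValue ν k ≤ 0 :=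
  Real.iSup_le (fun _ => integral_nonpos fun t => assortmentUtility_nonpos _ t) le_rfl

variable {ν : Measure (Feature d)} [IsProbabilityMeasure ν]

lemma integrable_utility (hν : MemLp id 2 ν) (x : Feature d) :
    Integrable (fun t => utility t x) ν := by
  have h := (((memLp_const x).sub hν).integrable_norm_pow (by norm_num)).const_mul (-(1 / 2) : ℝ)
  simpa [utility] using h

lemma integrable_assortmentUtility (hν : MemLp id 2 ν) {S : Finset (Feature d)}
    (hS : S.Nonempty) : Integrable (assortmentUtility S) ν := by
  obtain ⟨x, hx⟩ := hS
  refine (integrable_utility hν x).mono (measurable_assortmentUtility S).aestronglyMeasurable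
    (ae_of_all _ fun t => ?_)
  rw [Real.norm_of_nonpos (assortmentUtility_nonpos S t), Real.norm_of_nonpos (utility_nonpos t x)]
  exact neg_le_neg (utility_le_assortmentUtility hx t)

/-- Along an exhaustion of a dense sequence the distance to the assortment tends to zero; the
utility of the single product `0` dominates. -/
lemma exists_integral_assortmentUtility_gt (hν : MemLp id 2 ν) {ε : ℝ} (hε : 0 < ε) :
    ∃ S : Finset (Feature d), S.Nonempty ∧ -ε < ∫ t, assortmentUtility S t ∂ν := by
  classical
  let u := TopologicalSpace.denseSeq (Feature d)
  let T : ℕ → Finset (Feature d) := fun n => insert 0 ((Finset.range n).image u)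
  have hlim : Tendsto (fun n => ∫ t, assortmentUtility (T n) t ∂ν) atTop (𝓝 (∫ _, (0 : ℝ) ∂ν)) := by
    refine tendsto_integral_of_dominated_convergence (fun t => ‖utility t 0‖)
      (fun n => (measurable_assortmentUtility _).aestronglyMeasurable)
      (integrable_utility hν 0).norm (fun n => ae_of_all _ fun t => ?_) (ae_of_all _ fun t => ?_)
    · rw [Real.norm_of_nonpos (assortmentUtility_nonpos _ t),
        Real.norm_of_nonpos (utility_nonpos t 0)]
      exact neg_le_neg (utility_le_assortmentUtility (Finset.mem_insert_self _ _) t)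
    · rw [Metric.tendsto_atTop]
      intro η hη
      obtain ⟨n, hn⟩ := (TopologicalSpace.denseRange_denseSeq (Feature d)).exists_dist_lt t
        (Real.sqrt_pos.2 hη)
      refine ⟨n + 1, fun k hk => ?_⟩
      rw [Real.dist_eq, sub_zero, abs_of_nonpos (assortmentUtility_nonpos _ t)]
      have hmem : u n ∈ T k :=
        Finset.mem_insert_of_mem (Finset.mem_image_of_mem u (Finset.mem_range.2 (by omega)))
      have h1 := utility_le_assortmentUtility hmem t
      have h2 : ‖u n - t‖ ^ 2 < η := by
        rw [← Real.lt_sqrt (norm_nonneg _), ← dist_eq_norm, dist_comm]; exact hn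
      unfold utility at h1
      linarith
  rw [integral_zero] at hlim
  obtain ⟨n, hn⟩ := (hlim.eventually (lt_mem_nhds (neg_neg_of_pos hε))).exists
  exact ⟨T n, ⟨0, Finset.mem_insert_self _ _⟩, hn⟩

/-- Under a belief with finite second moment the value of large assortments tends to the full
information value `0`. -/
theorem tendsto_optimalValue (hd : 1 ≤ d) (hν : MemLp id 2 ν) :
    Tendsto (fun k => optimalValue ν k) atTop (𝓝 0) := by
  have : Nonempty (Fin d) := ⟨⟨0, hd⟩⟩
  have : Infinite (Feature d) := Module.Free.infinite ℝ (Feature d)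
  rw [Metric.tendsto_atTop]
  intro ε hε
  obtain ⟨S, hS, hlt⟩ := exists_integral_assortmentUtility_gt hν hε
  refine ⟨S.card, fun k hk => ?_⟩
  obtain ⟨S', hSS', rfl⟩ := Infinite.exists_superset_card_eq S k hk
  have h := (integral_mono (integrable_assortmentUtility hν hS)
    (integrable_assortmentUtility hν (hS.mono hSS')) (assortmentUtility_mono hS hSS')).trans
    (integral_le_optimalValue ν S')
  rw [Real.dist_eq, sub_zero, abs_of_nonpos (optimalValue_nonpos ν _)]
  linarith

theorem limitValue_eq_zero (hd : 1 ≤ d) (hν : MemLp id 2 ν) : limitValue ν = 0 :=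
  (tendsto_optimalValue hd hν).limUnder_eq

/-- Bias–variance decomposition of the expected utility of a single product. -/
lemma integral_utility (hν : MemLp id 2 ν) (x : Feature d) :
    ∫ t, utility t x ∂ν =
      -(1 / 2) * (covMatrix ν).trace - (1 / 2) * ∑ i, (x i - ∫ t, t i ∂ν) ^ 2 := by
  have hc (i : Fin d) : MemLp (fun t : Feature d => t i) 2 ν := by
    have := (EuclideanSpace.proj (𝕜 := ℝ) i).comp_memLp' hν
    exact this
  have hsq (i : Fin d) : ∫ t, (x i - t i) ^ 2 ∂ν =
      covMatrix ν i i + (x i - ∫ t, t i ∂ν) ^ 2 := by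
    have h1 : MemLp (fun t : Feature d => x i - t i) 2 ν := (memLp_const (x i)).sub (hc i)
    have h2 := variance_eq_sub h1
    have h3 : Var[fun t : Feature d => x i - t i; ν] = covMatrix ν i i := by
      rw [covMatrix, Matrix.of_apply, covariance_self (hc i).aemeasurable]
      exact variance_const_sub (hc i).aestronglyMeasurable _
    have h4 : ∫ t : Feature d, (x i - t i) ∂ν = x i - ∫ t, t i ∂ν := by
      rw [integral_sub (integrable_const _) ((hc i).integrable (by norm_num))]; simp
    rw [h3, h4] at h2
    simp only [Pi.pow_apply] at h2
    linarith
  have hu : (fun t => utility t x) = fun t : Feature d => -(1 / 2) * ∑ i, (x i - t i) ^ 2 := by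
    ext t; simp [utility, EuclideanSpace.real_norm_sq_eq]
  rw [hu, integral_const_mul, integral_finsetSum]
  · simp_rw [hsq]
    rw [Finset.sum_add_distrib, Matrix.trace]
    simp only [Matrix.diag_apply]
    ring
  · intro i _
    exact ((memLp_const (x i)).sub (hc i)).integrable_sq

/-- The best single product is the posterior mean. -/
theorem optimalValue_one (hν : MemLp id 2 ν) :
    optimalValue ν 1 = -(1 / 2) * (covMatrix ν).trace := by
  have : Nonempty {S : Finset (Feature d) // S.card = 1} := ⟨⟨{0}, rfl⟩⟩
  apply le_antisymm
  · refine ciSup_le fun S => ?_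
    obtain ⟨x, hx⟩ := Finset.card_eq_one.1 S.2
    rw [hx]
    simp_rw [assortmentUtility_singleton]
    rw [integral_utility hν x]
    nlinarith [Finset.sum_nonneg fun i (_ : i ∈ Finset.univ) =>
      sq_nonneg (x i - ∫ t : Feature d, t i ∂ν)]
  · have h := integral_le_optimalValue ν {WithLp.toLp 2 fun i => ∫ t : Feature d, t i ∂ν}
    simp_rw [assortmentUtility_singleton] at h
    rw [integral_utility hν] at h
    simpa using h

end ValueTheory

open Matrix WithLp
open scoped MatrixOrder

/-! ### Gaussian densities and Bayes' rule -/

section GaussianDensity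

variable {d : ℕ}

lemma integral_exp_neg_norm_sq_div {s : ℝ} (hs : 0 < s) :
    ∫ x : Feature d, Real.exp (-(‖x‖ ^ 2 / (2 * s))) = (2 * Real.pi * s) ^ (d / 2 : ℝ) := by
  have h := GaussianFourier.integral_rexp_neg_mul_sq_norm (V := Feature d) (b := 1 / (2 * s))
    (by positivity)
  simp only [finrank_euclideanSpace, Fintype.card_fin] at h
  rw [show Real.pi / (1 / (2 * s)) = 2 * Real.pi * s by field_simp] at h
  rw [← h]
  congr with x
  congr 1
  ring

lemma integrable_exp_neg_norm_sq_div {s : ℝ} (hs : 0 < s) :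
    Integrable fun x : Feature d => Real.exp (-(‖x‖ ^ 2 / (2 * s))) := by
  by_contra h
  have h1 := integral_exp_neg_norm_sq_div (d := d) hs
  rw [integral_undef h] at h1
  have : 0 < (2 * Real.pi * s) ^ (d / 2 : ℝ) := by positivity
  linarith

open Complex in
/-- The density is identified through its characteristic function. -/
theorem stdGaussian_eq_withDensity (d : ℕ) :
    stdGaussian (Feature d) = volume.withDensity fun x => ENNReal.ofReal
      ((2 * Real.pi) ^ (-(d / 2 : ℝ)) * Real.exp (-(‖x‖ ^ 2 / 2))) := by
  have hint : Integrable (fun x : Feature d => Real.exp (-(‖x‖ ^ 2 / 2))) := by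
    simpa using integrable_exp_neg_norm_sq_div (d := d) one_pos
  have hfin : IsFiniteMeasure (volume.withDensity (fun x : Feature d => ENNReal.ofReal
      ((2 * Real.pi) ^ (-(d / 2 : ℝ)) * Real.exp (-(‖x‖ ^ 2 / 2))))) :=
    isFiniteMeasure_withDensity_ofReal (hint.const_mul _).2
  apply Measure.ext_of_charFun
  ext t
  rw [charFun_stdGaussian, charFun_apply, integral_withDensity_eq_integral_toReal_smul
    (by fun_prop) (ae_of_all _ fun _ => ENNReal.ofReal_lt_top)]
  have h := GaussianFourier.integral_cexp_neg_mul_sq_norm_add (V := Feature d) (b := 1 / 2)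
    (by norm_num) I t
  have e (x : Feature d) :
      (ENNReal.ofReal ((2 * Real.pi) ^ (-(d / 2 : ℝ)) * Real.exp (-(‖x‖ ^ 2 / 2)))).toReal •
        cexp (inner ℝ x t * I) =
      ((2 * Real.pi) ^ (-(d / 2 : ℝ)) : ℝ) * cexp (- (1 / 2) * ‖x‖ ^ 2 + I * inner ℝ t x) := by
    rw [ENNReal.toReal_ofReal (by positivity), real_smul, ofReal_mul, mul_assoc, ofReal_exp,
      ← Complex.exp_add, real_inner_comm]
    congr 2
    push_cast; ring
  simp_rw [e]
  rw [integral_const_mul, h, ← mul_assoc]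
  have e2 : (Real.pi / (1 / 2) : ℂ) ^ (Module.finrank ℝ (Feature d) / 2 : ℂ) =
      (((2 * Real.pi) ^ (d / 2 : ℝ) : ℝ) : ℂ) := by
    rw [ofReal_cpow (by positivity)]
    simp only [finrank_euclideanSpace, Fintype.card_fin]
    push_cast
    congr 1
    ring
  rw [e2, ← ofReal_mul, ← Real.rpow_add (by positivity)]
  simp only [neg_add_cancel, Real.rpow_zero, ofReal_one, one_mul, I_sq]
  congr 1
  ring

lemma lintegral_stdGaussian {F : Feature d → ENNReal} (hF : Measurable F) :
    ∫⁻ z, F z ∂stdGaussian (Feature d) = ENNReal.ofReal ((2 * Real.pi) ^ (-(d / 2 : ℝ))) *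
      ∫⁻ z, ENNReal.ofReal (Real.exp (-(‖z‖ ^ 2 / 2))) * F z := by
  rw [stdGaussian_eq_withDensity, lintegral_withDensity_eq_lintegral_mul _ (by fun_prop) hF,
    ← lintegral_const_mul _ (by fun_prop)]
  congr with z
  rw [Pi.mul_apply, ENNReal.ofReal_mul (by positivity), mul_assoc]

/-- Affine change of variables in Lebesgue measure. -/
lemma lintegral_comp_affine {A : Matrix (Fin d) (Fin d) ℝ} (hA : A.det ≠ 0) (a : Feature d)
    {G : Feature d → ENNReal} (hG : Measurable G) :
    ∫⁻ z : Feature d, G (a + toEuclideanCLM (𝕜 := ℝ) A z) =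
      ENNReal.ofReal |A.det⁻¹| * ∫⁻ y, G y := by
  have hdet : LinearMap.det (toEuclideanCLM (𝕜 := ℝ) A : Feature d →ₗ[ℝ] Feature d) = A.det := by
    rw [coe_toEuclideanCLM_eq_toEuclideanLin]
    change LinearMap.det (toLpLin 2 2 A) = _
    rw [toLpLin_eq_toLin, LinearMap.det_toLin]
  have h := Measure.map_linearMap_addHaar_eq_smul_addHaar (volume : Measure (Feature d))
    (f := (toEuclideanCLM (𝕜 := ℝ) A : Feature d →ₗ[ℝ] Feature d)) (hdet ▸ hA)
  rw [hdet] at h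
  have hm : Measurable (toEuclideanCLM (𝕜 := ℝ) A : Feature d →ₗ[ℝ] Feature d) :=
    (toEuclideanCLM (𝕜 := ℝ) A).continuous.measurable
  rw [← lintegral_add_left_eq_self G a, ← smul_eq_mul, ← lintegral_smul_measure, ← h,
    lintegral_map (by fun_prop) hm]
  rfl

lemma det_sqrt_sq {S : Matrix (Fin d) (Fin d) ℝ} (hS : S.PosDef) :
    (CFC.sqrt S).det ^ 2 = S.det := by
  rw [sq, ← det_mul, CFC.sqrt_mul_sqrt_self _ hS.posSemidef.nonneg]

lemma det_sqrt_ne_zero {S : Matrix (Fin d) (Fin d) ℝ} (hS : S.PosDef) :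
    (CFC.sqrt S).det ≠ 0 := by
  intro h
  have := det_sqrt_sq hS
  rw [h] at this
  have := hS.det_pos
  norm_num at *
  linarith

/-- The Gaussian law with covariance `S` has Lebesgue density proportional to
`exp (-½ (x - a)ᵀ S⁻¹ (x - a))`; the normalizing constant does not depend on the mean. -/
theorem lintegral_multivariateGaussian {S : Matrix (Fin d) (Fin d) ℝ} (hS : S.PosDef) :
    ∃ C : ENNReal, C ≠ 0 ∧ C ≠ ⊤ ∧ ∀ (a : Feature d) (F : Feature d → ENNReal), Measurable F →
      ∫⁻ x, F x ∂multivariateGaussian a S = C * ∫⁻ x, ENNReal.ofReal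
        (Real.exp (-(1 / 2) * ((x - a).ofLp ⬝ᵥ S⁻¹ *ᵥ (x - a).ofLp))) * F x := by
  set A := CFC.sqrt S with hAdef
  have hA : A.det ≠ 0 := det_sqrt_ne_zero hS
  have hAA : A * A = S := CFC.sqrt_mul_sqrt_self _ hS.posSemidef.nonneg
  have hAT : Aᵀ = A := by
    have := (CFC.sqrt_nonneg S).isSelfAdjoint
    simpa [IsSelfAdjoint, star_eq_conjTranspose, conjTranspose_eq_transpose_of_trivial] using this
  refine ⟨ENNReal.ofReal ((2 * Real.pi) ^ (-(d / 2 : ℝ))) * ENNReal.ofReal |A.det⁻¹|, ?_,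
    ENNReal.mul_ne_top ENNReal.ofReal_ne_top ENNReal.ofReal_ne_top, fun a F hF => ?_⟩
  · refine mul_ne_zero ?_ ?_
    · exact (ENNReal.ofReal_pos.2 (by positivity)).ne'
    · exact (ENNReal.ofReal_pos.2 (abs_pos.2 (inv_ne_zero hA))).ne'
  -- with `A` the symmetric square root of `S`, the substitution `x = a + A z` turns the
  -- quadratic form of `S⁻¹` into the squared norm
  have hquad (z : Feature d) : (toEuclideanCLM (𝕜 := ℝ) A z).ofLp ⬝ᵥ
      S⁻¹ *ᵥ (toEuclideanCLM (𝕜 := ℝ) A z).ofLp = ‖z‖ ^ 2 := by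
    rw [EuclideanSpace.real_norm_sq_eq, ofLp_toEuclideanCLM, mulVec_mulVec, ← hAA,
      Matrix.mul_inv_rev, mul_assoc, nonsing_inv_mul _ (isUnit_iff_ne_zero.2 hA), mul_one,
      dotProduct_mulVec]
    nth_rewrite 1 [← hAT]
    rw [mulVec_transpose, vecMul_vecMul, mul_nonsing_inv _ (isUnit_iff_ne_zero.2 hA), vecMul_one]
    simp [dotProduct, sq]
  rw [multivariateGaussian, ← hAdef, lintegral_map hF (by fun_prop),
    lintegral_stdGaussian (by fun_prop), mul_assoc, ← lintegral_comp_affine hA a (by fun_prop)]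
  congr with z
  rw [add_sub_cancel_left, hquad]
  congr 3
  ring

lemma integral_norm_sq_stdGaussian : ∫ z, ‖z‖ ^ 2 ∂stdGaussian (Feature d) = d := by
  rw [← multivariateGaussian_zero_one]
  have hc (i : Fin d) : MemLp (fun t : Feature d => t i) 2
      (multivariateGaussian 0 (1 : Matrix (Fin d) (Fin d) ℝ)) :=
    (EuclideanSpace.proj (𝕜 := ℝ) i).comp_memLp' IsGaussian.memLp_two_id
  simp_rw [EuclideanSpace.real_norm_sq_eq]
  rw [integral_finsetSum _ fun i _ => (hc i).integrable_sq]
  have (i : Fin d) : ∫ t : Feature d, (t i) ^ 2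
      ∂(multivariateGaussian 0 (1 : Matrix (Fin d) (Fin d) ℝ)) = 1 := by
    have h1 := variance_eq_sub (hc i)
    have h2 := variance_eval_multivariateGaussian (μ := (0 : Feature d))
      (PosSemidef.one (R := ℝ) (n := Fin d)) i
    have h3 : ∫ t : Feature d, t i
        ∂(multivariateGaussian 0 (1 : Matrix (Fin d) (Fin d) ℝ)) = 0 := by
      have := (EuclideanSpace.proj (𝕜 := ℝ) i).integral_comp_id_comm
        (μ := multivariateGaussian 0 (1 : Matrix (Fin d) (Fin d) ℝ)) IsGaussian.integrable_id
      simpa using this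
    rw [h2, h3] at h1
    simpa only [one_apply_eq, Pi.pow_apply, ne_eq, OfNat.ofNat_ne_zero, not_false_eq_true,
      zero_pow, sub_zero] using h1.symm
  simp only [this, Finset.sum_const, Finset.card_univ, Fintype.card_fin, nsmul_one]

lemma posDef_inv_add {S M : Matrix (Fin d) (Fin d) ℝ} (hS : S.PosDef) (hM : M.PosSemidef) :
    (S⁻¹ + M).PosDef :=
  hS.inv.add_posSemidef hM

/-- Bayes' rule for Gaussian priors, by completing the square: reweighting a Gaussian law by the
exponential of `bᵀx - ½ xᵀMx` gives a multiple of a Gaussian law with precision `S⁻¹ + M`. -/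
theorem multivariateGaussian_withDensity_exp {S M : Matrix (Fin d) (Fin d) ℝ} (hS : S.PosDef)
    (hM : M.PosSemidef) (a : Feature d) (b : Fin d → ℝ) :
    ∃ (K : ENNReal) (m : Feature d), K ≠ 0 ∧ K ≠ ⊤ ∧
      (multivariateGaussian a S).withDensity (fun x => ENNReal.ofReal
        (Real.exp (b ⬝ᵥ x.ofLp - (1 / 2) * (x.ofLp ⬝ᵥ M *ᵥ x.ofLp)))) =
      K • multivariateGaussian m (S⁻¹ + M)⁻¹ := by
  set L := S⁻¹ + M with hL
  have hLp : L.PosDef := posDef_inv_add hS hM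
  have hsym {B : Matrix (Fin d) (Fin d) ℝ} (hB : B.IsHermitian) (x y : Fin d → ℝ) :
      x ⬝ᵥ B *ᵥ y = y ⬝ᵥ B *ᵥ x := by
    have hBT : Bᵀ = B := by rw [← conjTranspose_eq_transpose_of_trivial]; exact hB
    rw [dotProduct_mulVec, ← mulVec_transpose, hBT, dotProduct_comm]
  obtain ⟨C, hC0, hCt, hC⟩ := lintegral_multivariateGaussian hS
  obtain ⟨D, hD0, hDt, hD⟩ := lintegral_multivariateGaussian hLp.inv
  have hLL : (L⁻¹)⁻¹ = L := nonsing_inv_nonsing_inv _ (isUnit_iff_ne_zero.2 hLp.det_pos.ne')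
  -- the mean and the constant that complete the square
  let m : Feature d := toLp 2 (L⁻¹ *ᵥ (b + S⁻¹ *ᵥ a.ofLp))
  have hm : L *ᵥ m.ofLp = b + S⁻¹ *ᵥ a.ofLp := by
    simp only [m]
    rw [mulVec_mulVec, mul_nonsing_inv _ (isUnit_iff_ne_zero.2 hLp.det_pos.ne'), one_mulVec]
  let c : ℝ := (1 / 2) * (m.ofLp ⬝ᵥ L *ᵥ m.ofLp) - (1 / 2) * (a.ofLp ⬝ᵥ S⁻¹ *ᵥ a.ofLp)
  have key (x : Feature d) : -(1 / 2) * ((x - a).ofLp ⬝ᵥ S⁻¹ *ᵥ (x - a).ofLp) +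
      (b ⬝ᵥ x.ofLp - (1 / 2) * (x.ofLp ⬝ᵥ M *ᵥ x.ofLp)) =
      c + -(1 / 2) * ((x - m).ofLp ⬝ᵥ L *ᵥ (x - m).ofLp) := by
    have h1 := hsym hS.inv.isHermitian x.ofLp a.ofLp
    have h2 := hsym hLp.isHermitian x.ofLp m.ofLp
    have h3 : x.ofLp ⬝ᵥ L *ᵥ m.ofLp = x.ofLp ⬝ᵥ b + x.ofLp ⬝ᵥ S⁻¹ *ᵥ a.ofLp := by
      rw [hm, dotProduct_add]
    have h4 : x.ofLp ⬝ᵥ L *ᵥ x.ofLp = x.ofLp ⬝ᵥ S⁻¹ *ᵥ x.ofLp + x.ofLp ⬝ᵥ M *ᵥ x.ofLp := by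
      rw [hL, add_mulVec, dotProduct_add]
    have h5 := dotProduct_comm b x.ofLp
    simp only [ofLp_sub, mulVec_sub, dotProduct_sub, sub_dotProduct, c]
    linarith
  refine ⟨C * ENNReal.ofReal (Real.exp c) * D⁻¹, m, ?_, ?_, ?_⟩
  · exact mul_ne_zero (mul_ne_zero hC0 (ENNReal.ofReal_pos.2 (Real.exp_pos c)).ne')
      (ENNReal.inv_ne_zero.2 hDt)
  · exact ENNReal.mul_ne_top (ENNReal.mul_ne_top hCt ENNReal.ofReal_ne_top)
      (ENNReal.inv_ne_top.2 hD0)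
  refine Measure.ext_of_lintegral _ fun F hF => ?_
  have hmeas (B : Matrix (Fin d) (Fin d) ℝ) (v : Feature d) : Measurable fun x : Feature d =>
      (x - v).ofLp ⬝ᵥ B *ᵥ (x - v).ofLp := by
    simp only [dotProduct, mulVec]; fun_prop
  have hmeas' : Measurable fun x : Feature d =>
      b ⬝ᵥ x.ofLp - (1 / 2) * (x.ofLp ⬝ᵥ M *ᵥ x.ofLp) := by
    simp only [dotProduct, mulVec]; fun_prop
  rw [lintegral_withDensity_eq_lintegral_mul _ (by fun_prop) hF, hC _ _ (by fun_prop),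
    lintegral_smul_measure, hD _ _ hF, hLL, smul_eq_mul]
  have e (x : Feature d) : ENNReal.ofReal
        (Real.exp (-(1 / 2) * ((x - a).ofLp ⬝ᵥ S⁻¹ *ᵥ (x - a).ofLp))) * ((fun x : Feature d =>
          ENNReal.ofReal (Real.exp (b ⬝ᵥ x.ofLp - (1 / 2) * (x.ofLp ⬝ᵥ M *ᵥ x.ofLp)))) * F) x =
      ENNReal.ofReal (Real.exp c) * (ENNReal.ofReal
        (Real.exp (-(1 / 2) * ((x - m).ofLp ⬝ᵥ L *ᵥ (x - m).ofLp))) * F x) := by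
    rw [Pi.mul_apply, ← mul_assoc, ← mul_assoc, ← ENNReal.ofReal_mul (Real.exp_pos _).le,
      ← ENNReal.ofReal_mul (Real.exp_pos _).le, ← Real.exp_add, ← Real.exp_add, key]
  simp_rw [e]
  have hmL := hmeas L m
  rw [lintegral_const_mul _ (by fun_prop)]
  simp only [mul_assoc]
  rw [← mul_assoc D⁻¹ D, ENNReal.inv_mul_cancel hD0 hDt, one_mul]

lemma covMatrix_multivariateGaussian {S : Matrix (Fin d) (Fin d) ℝ} (hS : S.PosSemidef)
    (a : Feature d) : covMatrix (multivariateGaussian a S) = S := by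
  ext i j
  exact covariance_eval_multivariateGaussian hS i j

end GaussianDensity

/-! ### Shannon lower bound for assortments -/

section ShannonBound

variable {d : ℕ}

lemma lintegral_exp_neg_norm_sq_sub_div {s : ℝ} (hs : 0 < s) (x : Feature d) :
    ∫⁻ y : Feature d, ENNReal.ofReal (Real.exp (-(‖x - y‖ ^ 2 / (2 * s)))) =
      ENNReal.ofReal ((2 * Real.pi * s) ^ (d / 2 : ℝ)) := by
  rw [← integral_exp_neg_norm_sq_div hs, ofReal_integral_eq_lintegral_ofReal
    (integrable_exp_neg_norm_sq_div hs) (ae_of_all _ fun _ => (Real.exp_pos _).le)]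
  exact lintegral_sub_left_eq_self
    (fun y : Feature d => ENNReal.ofReal (Real.exp (-(‖y‖ ^ 2 / (2 * s))))) x

/-- The likelihood ratio between the uniform mixture of the laws `N(x, s I)`, `x ∈ T`, and the
Gaussian belief has mean one; keeping only the dominant mixture component, whose exponent is the
assortment utility divided by `s`, gives mean at most one. -/
lemma lintegral_exp_assortmentUtility_le {S : Matrix (Fin d) (Fin d) ℝ} (hS : S.PosDef)
    (a : Feature d) {T : Finset (Feature d)} (hT : T.Nonempty) {s : ℝ} (hs : 0 < s) :
    ∫⁻ z, ENNReal.ofReal (Real.exp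
      ((Real.log |(CFC.sqrt S).det| - Real.log T.card - d / 2 * Real.log s) + (‖z‖ ^ 2 / 2 +
        assortmentUtility T (a + toEuclideanCLM (𝕜 := ℝ) (CFC.sqrt S) z) / s)))
      ∂stdGaussian (Feature d) ≤ 1 := by
  set A := CFC.sqrt S with hAdef
  have hA : A.det ≠ 0 := det_sqrt_ne_zero hS
  have hA' : 0 < |A.det| := abs_pos.2 hA
  have hk : (0 : ℝ) < T.card := by exact_mod_cast hT.card_pos
  set c : ℝ := Real.log |A.det| - Real.log T.card - d / 2 * Real.log s with hc
  have hmeas := measurable_assortmentUtility T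
  have hpt (y : Feature d) : ENNReal.ofReal (Real.exp (assortmentUtility T y / s)) ≤
      ∑ x ∈ T, ENNReal.ofReal (Real.exp (-(‖x - y‖ ^ 2 / (2 * s)))) := by
    obtain ⟨x, hx, he⟩ := exists_assortmentUtility_eq hT y
    refine le_trans (le_of_eq ?_) (Finset.single_le_sum
      (f := fun x => ENNReal.ofReal (Real.exp (-(‖x - y‖ ^ 2 / (2 * s)))))
      (fun _ _ => zero_le) hx)
    rw [he, utility]
    congr 2
    field_simp
  have hexp : Real.exp c = |A.det| / T.card / s ^ (d / 2 : ℝ) := by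
    rw [hc, Real.exp_sub, Real.exp_sub, Real.exp_log hA', Real.exp_log hk, mul_comm,
      ← Real.rpow_def_of_pos hs]
  rw [lintegral_stdGaussian (by fun_prop)]
  have e (z : Feature d) : ENNReal.ofReal (Real.exp (-(‖z‖ ^ 2 / 2))) * ENNReal.ofReal (Real.exp
      (c + (‖z‖ ^ 2 / 2 + assortmentUtility T (a + toEuclideanCLM (𝕜 := ℝ) A z) / s))) =
      ENNReal.ofReal (Real.exp c) * ENNReal.ofReal (Real.exp
        (assortmentUtility T (a + toEuclideanCLM (𝕜 := ℝ) A z) / s)) := by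
    rw [← ENNReal.ofReal_mul (Real.exp_pos _).le, ← ENNReal.ofReal_mul (Real.exp_pos _).le,
      ← Real.exp_add, ← Real.exp_add]
    congr 2
    ring
  simp_rw [e]
  rw [lintegral_const_mul _ (by fun_prop), lintegral_comp_affine hA a
    (G := fun y => ENNReal.ofReal (Real.exp (assortmentUtility T y / s))) (by fun_prop)]
  calc _ ≤ ENNReal.ofReal ((2 * Real.pi) ^ (-(d / 2 : ℝ))) * (ENNReal.ofReal (Real.exp c) *
        (ENNReal.ofReal |A.det⁻¹| * ∫⁻ y, ∑ x ∈ T,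
          ENNReal.ofReal (Real.exp (-(‖x - y‖ ^ 2 / (2 * s)))))) := by
        gcongr with y
        exact hpt y
    _ = ENNReal.ofReal ((2 * Real.pi) ^ (-(d / 2 : ℝ)) * (Real.exp c *
        (|A.det⁻¹| * (T.card * (2 * Real.pi * s) ^ (d / 2 : ℝ))))) := by
        rw [lintegral_finsetSum _ fun x _ => by fun_prop]
        simp_rw [lintegral_exp_neg_norm_sq_sub_div hs]
        rw [Finset.sum_const, nsmul_eq_mul, ENNReal.ofReal_mul (by positivity),
          ENNReal.ofReal_mul (by positivity), ENNReal.ofReal_mul (by positivity),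
          ENNReal.ofReal_mul (by positivity), ENNReal.ofReal_natCast]
    _ = 1 := by
        rw [← ENNReal.ofReal_one, hexp, abs_inv, Real.mul_rpow (by positivity) hs.le,
          Real.rpow_neg (by positivity)]
        congr 1
        have h1 : (2 * Real.pi) ^ (d / 2 : ℝ) ≠ 0 := by positivity
        have h2 : s ^ (d / 2 : ℝ) ≠ 0 := by positivity
        field_simp

/-- Non-negativity of the relative entropy of the belief with respect to a mixture of `T.card`
isotropic Gaussians of variance `s`. -/
lemma integral_assortmentUtility_div_le {S : Matrix (Fin d) (Fin d) ℝ} (hS : S.PosDef)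
    (a : Feature d) {T : Finset (Feature d)} (hT : T.Nonempty) {s : ℝ} (hs : 0 < s) :
    (∫ t, assortmentUtility T t ∂multivariateGaussian a S) / s ≤
      Real.log T.card + d / 2 * Real.log s - Real.log S.det / 2 - d / 2 := by
  have hbound := lintegral_exp_assortmentUtility_le hS a hT hs
  have hlog : Real.log |(CFC.sqrt S).det| = Real.log S.det / 2 := by
    rw [← det_sqrt_sq hS, Real.log_pow, Real.log_abs]
    push_cast; ring
  have hmeas := measurable_assortmentUtility T
  set c : ℝ := Real.log |(CFC.sqrt S).det| - Real.log T.card - d / 2 * Real.log s with hc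
  set w : Feature d → ℝ := fun z => ‖z‖ ^ 2 / 2 +
    assortmentUtility T (a + toEuclideanCLM (𝕜 := ℝ) (CFC.sqrt S) z) / s with hw
  have hu : Integrable (fun z => Real.exp (c + w z)) (stdGaussian (Feature d)) := by
    refine ⟨by fun_prop, ?_⟩
    rw [hasFiniteIntegral_iff_ofReal (ae_of_all _ fun _ => (Real.exp_pos _).le)]
    exact hbound.trans_lt ENNReal.one_lt_top
  have hu1 : ∫ z, Real.exp (c + w z) ∂stdGaussian (Feature d) ≤ 1 := by
    rw [integral_eq_lintegral_of_nonneg_ae (ae_of_all _ fun _ => (Real.exp_pos _).le)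
      hu.aestronglyMeasurable]
    exact ENNReal.toReal_le_of_le_ofReal zero_le_one (by simpa using hbound)
  have hi1 : Integrable (fun z : Feature d => ‖z‖ ^ 2 / 2) (stdGaussian (Feature d)) :=
    (IsGaussian.memLp_two_id.integrable_norm_pow (by norm_num)).div_const 2
  have hi2 : Integrable (fun z : Feature d =>
      assortmentUtility T (a + toEuclideanCLM (𝕜 := ℝ) (CFC.sqrt S) z) / s)
      (stdGaussian (Feature d)) := by
    have h := integrable_assortmentUtility (ν := multivariateGaussian a S)
      IsGaussian.memLp_two_id hT
    exact ((integrable_map_measure hmeas.aestronglyMeasurable (by fun_prop)).1 h).div_const s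
  have hw1 : ∫ z, w z ∂stdGaussian (Feature d) =
      d / 2 + (∫ t, assortmentUtility T t ∂multivariateGaussian a S) / s := by
    rw [hw, integral_add hi1 hi2, integral_div, integral_div, integral_norm_sq_stdGaussian,
      multivariateGaussian, integral_map (by fun_prop) hmeas.aestronglyMeasurable]
  have hwi : Integrable w (stdGaussian (Feature d)) := hi1.add hi2
  have hcw : Integrable (fun z => c + w z) (stdGaussian (Feature d)) := (integrable_const c).add hwi
  have hle : ∫ z, (c + w z + 1) ∂stdGaussian (Feature d) ≤ 1 :=
    (integral_mono (hcw.add (integrable_const 1)) hu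
      fun z => Real.add_one_le_exp (c + w z)).trans hu1
  rw [integral_add hcw (integrable_const 1), integral_add (integrable_const c) hwi, hw1] at hle
  simp only [integral_const, probReal_univ, one_smul] at hle
  rw [hc, hlog] at hle
  linarith

/-- Shannon lower bound on the quantization error of a Gaussian belief, in terms of the value of
an assortment. -/
theorem integral_assortmentUtility_le (hd : 1 ≤ d) {S : Matrix (Fin d) (Fin d) ℝ} (hS : S.PosDef)
    (a : Feature d) {T : Finset (Feature d)} (hT : T.Nonempty) :
    ∫ t, assortmentUtility T t ∂multivariateGaussian a S ≤
      -(1 / 2) * (d * S.det ^ (1 / d : ℝ) * (T.card : ℝ) ^ (-(2 / d : ℝ))) := by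
  have hk : (0 : ℝ) < T.card := by exact_mod_cast hT.card_pos
  have hd' : (0 : ℝ) < d := by exact_mod_cast hd
  have hdet := hS.det_pos
  -- the variance that makes the two logarithmic terms of the entropy bound cancel
  set s : ℝ := S.det ^ (1 / d : ℝ) * (T.card : ℝ) ^ (-(2 / d : ℝ)) with hs
  have hs0 : 0 < s := by positivity
  have h := integral_assortmentUtility_div_le hS a hT hs0
  have hlog : d / 2 * Real.log s = Real.log S.det / 2 - Real.log T.card := by
    rw [hs, Real.log_mul (by positivity) (by positivity), Real.log_rpow hdet, Real.log_rpow hk]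
    field_simp
    ring
  rw [hlog, div_le_iff₀ hs0] at h
  rw [mul_assoc (d : ℝ), ← hs]
  linarith

theorem optimalValue_multivariateGaussian_le (hd : 1 ≤ d) {S : Matrix (Fin d) (Fin d) ℝ}
    (hS : S.PosDef) (a : Feature d) {k : ℕ} (hk : 1 ≤ k) :
    optimalValue (multivariateGaussian a S) k ≤
      -(1 / 2) * (d * S.det ^ (1 / d : ℝ) * (k : ℝ) ^ (-(2 / d : ℝ))) := by
  have : Nonempty (Fin d) := ⟨⟨0, hd⟩⟩
  have : Infinite (Feature d) := Module.Free.infinite ℝ (Feature d)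
  obtain ⟨T₀, hT₀⟩ := Infinite.exists_subset_card_eq (Feature d) k
  have : Nonempty {T : Finset (Feature d) // T.card = k} := ⟨⟨T₀, hT₀⟩⟩
  refine ciSup_le fun T => ?_
  have h := integral_assortmentUtility_le hd hS a (T := T.1)
    (Finset.card_pos.1 (by rw [T.2]; omega))
  rwa [T.2] at h

/-- An assortment of `k` products has gap at most `δ` only if `k` is at least of order
`δ ^ (-d / 2)`. -/
theorem le_card_of_gap_le (hd : 1 ≤ d) {S : Matrix (Fin d) (Fin d) ℝ} (hS : S.PosDef)
    (a : Feature d) {k : ℕ} (hk : 1 ≤ k) {δ : ℝ} (hδ : 0 < δ)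
    (h : -optimalValue (multivariateGaussian a S) k ≤ δ) :
    ((d : ℝ) * S.det ^ (1 / (d : ℝ)) / (2 * δ)) ^ ((d : ℝ) / 2) ≤ k := by
  have hk' : (0 : ℝ) < k := by exact_mod_cast hk
  have hd' : (0 : ℝ) < d := by exact_mod_cast hd
  have hdet := hS.det_pos
  have h1 := optimalValue_multivariateGaussian_le hd hS a hk
  have h2 : (d : ℝ) * S.det ^ (1 / (d : ℝ)) / (2 * δ) ≤ (k : ℝ) ^ (2 / d : ℝ) := by
    rw [Real.rpow_neg hk'.le] at h1
    rw [div_le_iff₀ (by positivity)]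
    have h3 : (d : ℝ) * S.det ^ (1 / (d : ℝ)) * ((k : ℝ) ^ (2 / d : ℝ))⁻¹ ≤ 2 * δ := by linarith
    rw [← div_eq_mul_inv, div_le_iff₀ (by positivity)] at h3
    linarith
  calc _ ≤ ((k : ℝ) ^ (2 / d : ℝ)) ^ ((d : ℝ) / 2) :=
        Real.rpow_le_rpow (by positivity) h2 (by positivity)
    _ = k := by
        rw [← Real.rpow_mul hk'.le]
        field_simp
        exact Real.rpow_one _

end ShannonBound

/-! ### Law of the transcript and the posterior -/

section Posterior

variable {d : ℕ}

/-- Cameron–Martin formula for a shift of a centred real Gaussian law. -/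
lemma lintegral_gaussianReal_const_add {σ : ℝ} (hσ : 0 < σ) (c : ℝ) {G : ℝ → ENNReal}
    (hG : Measurable G) :
    ∫⁻ e, G (c + e) ∂gaussianReal 0 (σ ^ 2).toNNReal =
      ∫⁻ z, ENNReal.ofReal (Real.exp ((z * c - c ^ 2 / 2) / σ ^ 2)) * G z
        ∂gaussianReal 0 (σ ^ 2).toNNReal := by
  have hv : (σ ^ 2).toNNReal ≠ 0 := by
    rw [ne_eq, Real.toNNReal_eq_zero, not_le]; positivity
  rw [← lintegral_map (μ := gaussianReal 0 (σ ^ 2).toNNReal) (g := fun e => c + e) hG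
      (by fun_prop),
    gaussianReal_map_const_add, gaussianReal_of_var_ne_zero _ hv, gaussianReal_of_var_ne_zero _ hv,
    lintegral_withDensity_eq_lintegral_mul _ (measurable_gaussianPDF _ _) hG,
    lintegral_withDensity_eq_lintegral_mul _ (measurable_gaussianPDF _ _) (by fun_prop)]
  congr with z
  rw [Pi.mul_apply, Pi.mul_apply, ← mul_assoc]
  congr 1
  rw [gaussianPDF, gaussianPDF, ← ENNReal.ofReal_mul (gaussianPDFReal_nonneg _ _ _),
    gaussianPDFReal, gaussianPDFReal, mul_assoc (Real.sqrt _)⁻¹, ← Real.exp_add,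
    Real.coe_toNNReal _ (sq_nonneg σ)]
  congr 3
  field_simp
  ring

/-- Extend a transcript by one round with the given response. -/
def extend (π : Policy d) (t : ℕ) (p : History d t × ℝ) : History d (t + 1) :=
  Fin.snoc (α := fun _ => Feature d × ℝ) p.1 (π.query t p.1, p.2)

lemma measurable_extend (π : Policy d) (t : ℕ) : Measurable (extend π t) := by
  refine measurable_pi_iff.2 fun i => ?_
  have hq := π.measurable_query t
  induction i using Fin.lastCases with
  | last => simp only [extend, Fin.snoc_last]; fun_prop
  | cast i => simp only [extend, Fin.snoc_castSucc]; fun_prop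

lemma history_succ (π : Policy d) (x : Feature d) (e : ℕ → ℝ) (t : ℕ) :
    history π x e (t + 1) =
      extend π t (history π x e t, inner ℝ x (π.query t (history π x e t)) + e t) := rfl

lemma measurable_history (π : Policy d) (t : ℕ) :
    Measurable fun p : Feature d × (ℕ → ℝ) => history π p.1 p.2 t := by
  induction t with
  | zero => exact measurable_pi_iff.2 fun i => i.elim0
  | succ t ih =>
    have hq := π.measurable_query t
    simp only [history_succ]
    exact (measurable_extend π t).comp (by fun_prop)

lemma history_congr (π : Policy d) (x : Feature d) {e e' : ℕ → ℝ} {t : ℕ}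
    (h : ∀ i < t, e i = e' i) : history π x e t = history π x e' t := by
  induction t with
  | zero => rfl
  | succ t ih =>
    rw [history_succ, history_succ, ih fun i hi => h i (by omega), h t (by omega)]

lemma norm_history_query (π : Policy d) (x : Feature d) (e : ℕ → ℝ) {t : ℕ} (i : Fin t) :
    ‖(history π x e t i).1‖ = 1 := by
  induction t with
  | zero => exact i.elim0
  | succ t ih =>
    rw [history_succ, extend]
    induction i using Fin.lastCases with
    | last => simpa using π.norm_query t _
    | cast i => simpa using ih i

/-- The law of the transcript when all responses are pure noise, that is when the ideal point
is `0`. -/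
noncomputable def nullLaw (π : Policy d) (σ : ℝ) : (t : ℕ) → Measure (History d t)
  | 0 => Measure.dirac Fin.elim0
  | t + 1 => ((nullLaw π σ t).prod (gaussianReal 0 (σ ^ 2).toNNReal)).map (extend π t)

instance isProbabilityMeasure_nullLaw (π : Policy d) (σ : ℝ) (t : ℕ) :
    IsProbabilityMeasure (nullLaw π σ t) := by
  induction t with
  | zero => exact Measure.dirac.isProbabilityMeasure
  | succ t ih => exact Measure.isProbabilityMeasure_map (measurable_extend π t).aemeasurable

/-- The log-likelihood of the ideal point `x` given a transcript, relative to the ideal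
point `0`. -/
noncomputable def logLikelihood (σ : ℝ) {t : ℕ} (x : Feature d) (h : History d t) : ℝ :=
  ∑ i, ((h i).2 * inner ℝ x (h i).1 - inner ℝ x (h i).1 ^ 2 / 2) / σ ^ 2

lemma measurable_logLikelihood (σ : ℝ) (t : ℕ) :
    Measurable fun p : Feature d × History d t => logLikelihood σ p.1 p.2 := by
  unfold logLikelihood
  fun_prop

lemma logLikelihood_extend (σ : ℝ) (π : Policy d) {t : ℕ} (x : Feature d) (h : History d t)
    (z : ℝ) : logLikelihood σ x (extend π t (h, z)) = logLikelihood σ x h +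
      (z * inner ℝ x (π.query t h) - inner ℝ x (π.query t h) ^ 2 / 2) / σ ^ 2 := by
  simp [logLikelihood, extend, Fin.sum_univ_castSucc]

variable {Ω : Type*} [MeasurableSpace Ω] {P : Measure Ω}

/-- The transcript up to round `t` is a function of the noise in the rounds before `t`. -/
lemma indepFun_history_noise {noise : ℕ → Ω → ℝ} (hm : ∀ t, Measurable (noise t))
    (hn : iIndepFun noise P) (π : Policy d) (x : Feature d) (t : ℕ) :
    IndepFun (fun ω => history π x (fun i => noise i ω) t) (noise t) P := by
  have h := hn.indepFun_finset (Finset.range t) {t} (by simp) hm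
  let g : (Finset.range t → ℝ) → History d t := fun w =>
    history π x (fun i => if hi : i ∈ Finset.range t then w ⟨i, hi⟩ else 0) t
  -- `g` pads the noise from round `t` on with zeros
  have hpad (i : ℕ) : Measurable fun w : Finset.range t → ℝ =>
      if hi : i ∈ Finset.range t then w ⟨i, hi⟩ else 0 := by
    by_cases hi : i ∈ Finset.range t
    · simp_rw [dif_pos hi]; exact measurable_pi_apply _
    · simp_rw [dif_neg hi]; exact measurable_const
  have hg : Measurable g :=
    (measurable_history π t).comp (measurable_const.prodMk (measurable_pi_iff.2 hpad))
  have h' := h.comp hg (measurable_pi_apply (⟨t, Finset.mem_singleton_self t⟩ : ({t} : Finset ℕ)))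
  convert! h' using 1
  ext1 ω
  refine history_congr π x fun i hi => ?_
  simp [hi]

variable [IsProbabilityMeasure P]

/-- For a fixed ideal point `x` the law of the transcript has density `exp (logLikelihood)` with
respect to `nullLaw`: given the transcript so far, the next query is fixed and the next response
is a shifted centred Gaussian. -/
lemma lintegral_history_of_ideal {noise : ℕ → Ω → ℝ} {σ : ℝ} (hσ : 0 < σ)
    (hm : ∀ t, Measurable (noise t)) (hn : iIndepFun noise P)
    (hl : ∀ t, P.map (noise t) = gaussianReal 0 (σ ^ 2).toNNReal) (π : Policy d) (x : Feature d)
    (t : ℕ) {F : History d t → ENNReal} (hF : Measurable F) :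
    ∫⁻ ω, F (history π x (fun i => noise i ω) t) ∂P =
      ∫⁻ h, ENNReal.ofReal (Real.exp (logLikelihood σ x h)) * F h ∂nullLaw π σ t := by
  have hhist (t : ℕ) : Measurable fun ω => history π x (fun i => noise i ω) t :=
    (measurable_history π t).comp (measurable_const.prodMk (measurable_pi_iff.2 hm))
  have hlik (t : ℕ) : Measurable fun h : History d t => logLikelihood σ x h :=
    (measurable_logLikelihood σ t).comp (measurable_const.prodMk measurable_id)
  induction t with
  | zero =>
    have := hlik 0
    rw [nullLaw, lintegral_dirac' _ (by fun_prop)]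
    simp [logLikelihood, history]
  | succ t ih =>
    have hq := π.measurable_query t
    have hext := measurable_extend π t
    have hl1 := hlik (t + 1)
    have hl0 := hlik t
    have hind := (indepFun_iff_map_prod_eq_prod_map_map (hhist t).aemeasurable
      (hm t).aemeasurable).1 (indepFun_history_noise hm hn π x t)
    let G : History d t × ℝ → ENNReal := fun p =>
      F (extend π t (p.1, inner ℝ x (π.query t p.1) + p.2))
    have hG : Measurable G := hF.comp (hext.comp (by fun_prop))
    calc ∫⁻ ω, F (history π x (fun i => noise i ω) (t + 1)) ∂P
        = ∫⁻ ω, G (history π x (fun i => noise i ω) t, noise t ω) ∂P := rfl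
      _ = ∫⁻ p, G p ∂(P.map fun ω => history π x (fun i => noise i ω) t).prod
            (gaussianReal 0 (σ ^ 2).toNNReal) := by
          rw [← hl t, ← hind, lintegral_map hG ((hhist t).prodMk (hm t))]
      _ = ∫⁻ ω, ∫⁻ e, G (history π x (fun i => noise i ω) t, e)
            ∂gaussianReal 0 (σ ^ 2).toNNReal ∂P := by
          rw [lintegral_prod _ hG.aemeasurable, lintegral_map hG.lintegral_prod_right' (hhist t)]
      _ = ∫⁻ h, ∫⁻ e, ENNReal.ofReal (Real.exp (logLikelihood σ x h)) * G (h, e)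
            ∂gaussianReal 0 (σ ^ 2).toNNReal ∂nullLaw π σ t := by
          rw [ih (F := fun h => ∫⁻ e, G (h, e) ∂gaussianReal 0 (σ ^ 2).toNNReal)
            hG.lintegral_prod_right']
          refine lintegral_congr fun h => ?_
          rw [lintegral_const_mul _ (by fun_prop)]
      _ = ∫⁻ h, ∫⁻ z, ENNReal.ofReal (Real.exp (logLikelihood σ x (extend π t (h, z)))) *
            F (extend π t (h, z)) ∂gaussianReal 0 (σ ^ 2).toNNReal ∂nullLaw π σ t := by
          refine lintegral_congr fun h => ?_
          have hFe : Measurable fun z => F (extend π t (h, z)) :=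
            hF.comp (hext.comp (by fun_prop))
          rw [lintegral_const_mul _ (by fun_prop),
            lintegral_gaussianReal_const_add hσ (inner ℝ x (π.query t h)) hFe,
            ← lintegral_const_mul _ (by fun_prop)]
          refine lintegral_congr fun z => ?_
          rw [logLikelihood_extend, Real.exp_add, ENNReal.ofReal_mul (Real.exp_pos _).le, mul_assoc]
      _ = _ := by
          rw [nullLaw, lintegral_map (by fun_prop) hext, lintegral_prod _ (by fun_prop)]

/-- The joint law of ideal point and transcript has density `exp (logLikelihood)` with respect to
the product of the prior and `nullLaw`, for adaptive policies as well. -/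
lemma lintegral_ideal_history {μ₀ : Feature d} {S₀ : Matrix (Fin d) (Fin d) ℝ} {σ : ℝ}
    (hσ : 0 < σ) {θ : Ω → Feature d} {noise : ℕ → Ω → ℝ}
    (hmodel : IsGaussianModel μ₀ S₀ σ P θ noise) (π : Policy d) (t : ℕ)
    {F : Feature d × History d t → ENNReal} (hF : Measurable F) :
    ∫⁻ ω, F (θ ω, randomHistory θ noise π t ω) ∂P =
      ∫⁻ h, ∫⁻ x, ENNReal.ofReal (Real.exp (logLikelihood σ x h)) * F (x, h)
        ∂multivariateGaussian μ₀ S₀ ∂nullLaw π σ t := by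
  have hnm : Measurable fun ω t => noise t ω := measurable_pi_iff.2 hmodel.measurable_noise
  have hind := (indepFun_iff_map_prod_eq_prod_map_map hmodel.measurable_ideal.aemeasurable
    hnm.aemeasurable).1 hmodel.indep_ideal_noise
  have : IsProbabilityMeasure (P.map fun ω t => noise t ω) :=
    Measure.isProbabilityMeasure_map hnm.aemeasurable
  have hlik := measurable_logLikelihood (d := d) σ t
  have hG : Measurable fun p : Feature d × (ℕ → ℝ) => F (p.1, history π p.1 p.2 t) :=
    hF.comp (measurable_fst.prodMk (measurable_history π t))
  calc _ = ∫⁻ p, F (p.1, history π p.1 p.2 t) ∂P.map fun ω => (θ ω, fun t => noise t ω) := by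
        rw [lintegral_map hG (hmodel.measurable_ideal.prodMk hnm)]
        rfl
    _ = ∫⁻ x, ∫⁻ ω, F (x, history π x (fun i => noise i ω) t) ∂P ∂multivariateGaussian μ₀ S₀ := by
        rw [hind, hmodel.law_ideal, lintegral_prod _ hG.aemeasurable]
        refine lintegral_congr fun x => ?_
        exact lintegral_map (hG.comp measurable_prodMk_left) hnm
    _ = ∫⁻ x, ∫⁻ h, ENNReal.ofReal (Real.exp (logLikelihood σ x h)) * F (x, h) ∂nullLaw π σ t
          ∂multivariateGaussian μ₀ S₀ := by
        refine lintegral_congr fun x => ?_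
        exact lintegral_history_of_ideal hσ hmodel.measurable_noise hmodel.indep_noise
          hmodel.law_noise π x t (hF.comp (by fun_prop))
    _ = _ := lintegral_lintegral_swap (by fun_prop)

lemma posSemidef_infoMatrix {m : ℕ} (h : History d m) : (infoMatrix h).PosSemidef := by
  refine posSemidef_sum _ fun t _ => ?_
  simpa using posSemidef_vecMulVec_self_star (R := ℝ) (h t).1.ofLp

/-- The log-likelihood is a quadratic polynomial in the ideal point. -/
lemma logLikelihood_eq (σ : ℝ) {t : ℕ} (x : Feature d) (h : History d t) :
    logLikelihood σ x h = (∑ i, ((h i).2 / σ ^ 2) • (h i).1.ofLp) ⬝ᵥ x.ofLp -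
      (1 / 2) * (x.ofLp ⬝ᵥ ((1 / σ ^ 2) • infoMatrix h) *ᵥ x.ofLp) := by
  have hin (i : Fin t) : inner ℝ x (h i).1 = (h i).1.ofLp ⬝ᵥ x.ofLp := by
    simp [EuclideanSpace.inner_eq_star_dotProduct]
  simp only [logLikelihood, infoMatrix, hin, sum_dotProduct, smul_dotProduct, smul_mulVec,
    sum_mulVec, dotProduct_smul, dotProduct_sum, vecMulVec_mulVec, Finset.mul_sum, smul_eq_mul,
    ← Finset.sum_sub_distrib]
  refine Finset.sum_congr rfl fun i _ => ?_
  simp only [op_smul_eq_smul, smul_eq_mul, dotProduct_comm x.ofLp]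
  ring

/-- Bayes' formula: if the joint law of `X` and `H` has density `f h x` with respect to a product
measure and each normalized density is the density of `ν h`, then `ν` is the conditional law
of `X` given `H`. -/
lemma condDistrib_eq_of_lintegral {α β : Type*} [MeasurableSpace α] [StandardBorelSpace α]
    [Nonempty α] [MeasurableSpace β] {X : Ω → α} {H : Ω → β} (hH : Measurable H)
    (hX : Measurable X) {ρ : Measure α} [SFinite ρ] {Q : Measure β} {f : β → α → ENNReal}
    (hf : Measurable (Function.uncurry f)) {K : β → ENNReal} {ν : β → Measure α}
    [∀ h, IsProbabilityMeasure (ν h)] (hK0 : ∀ h, K h ≠ 0) (hKt : ∀ h, K h ≠ ⊤)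
    (hν : ∀ h, ρ.withDensity (f h) = K h • ν h)
    (hjoint : ∀ F : β × α → ENNReal, Measurable F →
      ∫⁻ ω, F (H ω, X ω) ∂P = ∫⁻ h, ∫⁻ x, f h x * F (h, x) ∂ρ ∂Q) :
    ∀ᵐ ω ∂P, condDistrib X H P (H ω) = ν (H ω) := by
  have hfh (h : β) : Measurable (f h) := hf.comp measurable_prodMk_left
  have hKeq : K = fun h => ∫⁻ x, f h x ∂ρ := by
    ext h
    simpa [withDensity_apply] using (congrArg (fun μ => μ Set.univ) (hν h)).symm
  have hKm : Measurable K := hKeq ▸ hf.lintegral_prod_right'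
  have hg : Measurable (Function.uncurry fun h x => (K h)⁻¹ * f h x) :=
    (hKm.inv.comp measurable_fst).mul hf
  let κ : Kernel β α := Kernel.withDensity (Kernel.const _ ρ) fun h x => (K h)⁻¹ * f h x
  have hκ (h : β) : κ h = ν h := by
    rw [Kernel.withDensity_apply _ hg, Kernel.const_apply]
    change ρ.withDensity ((K h)⁻¹ • f h) = _
    rw [withDensity_smul _ (hfh h), hν, smul_smul, ENNReal.inv_mul_cancel (hK0 h) (hKt h), one_smul]
  have : IsMarkovKernel κ := ⟨fun h => by rw [hκ]; infer_instance⟩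
  have hprod : P.map (fun ω => (H ω, X ω)) = P.map H ⊗ₘ κ := by
    refine Measure.ext_of_lintegral _ fun F hF => ?_
    have hκF : Measurable fun h => ∫⁻ x, F (h, x) ∂κ h := hF.lintegral_kernel_prod_right'
    rw [lintegral_map hF (hH.prodMk hX), Measure.lintegral_compProd hF, lintegral_map hκF hH,
      hjoint F hF, hjoint (fun p => ∫⁻ x, F (p.1, x) ∂κ p.1) (hκF.comp measurable_fst)]
    refine lintegral_congr fun h => ?_
    have hFh : Measurable fun x => F (h, x) := hF.comp measurable_prodMk_left
    dsimp only
    rw [lintegral_mul_const _ (hfh h), hκ, ← congrFun hKeq h, ← smul_eq_mul,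
      ← lintegral_smul_measure, ← hν, lintegral_withDensity_eq_lintegral_mul _ (hfh h) hFh]
    rfl
  filter_upwards [ae_of_ae_map hH.aemeasurable
    (condDistrib_ae_eq_of_measure_eq_compProd H hX.aemeasurable hprod)] with ω hω
  rw [hω, hκ]

/-- The posterior is Gaussian, and its precision is the prior precision plus the information in
the queries that were actually made. -/
theorem posteriorAt_eq_multivariateGaussian {μ₀ : Feature d} {S₀ : Matrix (Fin d) (Fin d) ℝ}
    (hS : S₀.PosDef) {σ : ℝ} (hσ : 0 < σ) {θ : Ω → Feature d} {noise : ℕ → Ω → ℝ}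
    (hmodel : IsGaussianModel μ₀ S₀ σ P θ noise) (π : Policy d) (m : ℕ) :
    ∀ᵐ ω ∂P, ∃ a : Feature d, posteriorAt P θ noise π m ω = multivariateGaussian a
      (S₀⁻¹ + (1 / σ ^ 2) • infoMatrix (randomHistory θ noise π m ω))⁻¹ := by
  have hlik := measurable_logLikelihood (d := d) σ m
  let f : History d m → Feature d → ENNReal := fun h x =>
    ENNReal.ofReal (Real.exp (logLikelihood σ x h))
  have hf : Measurable (Function.uncurry f) :=
    (hlik.comp measurable_swap).exp.ennreal_ofReal
  have hbayes (h : History d m) : ∃ (K : ENNReal) (a : Feature d), K ≠ 0 ∧ K ≠ ⊤ ∧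
      (multivariateGaussian μ₀ S₀).withDensity (f h) =
        K • multivariateGaussian a (S₀⁻¹ + (1 / σ ^ 2) • infoMatrix h)⁻¹ := by
    obtain ⟨K, a, hK⟩ := multivariateGaussian_withDensity_exp hS
      ((posSemidef_infoMatrix h).smul (by positivity : (0 : ℝ) ≤ 1 / σ ^ 2)) μ₀
      (∑ i, ((h i).2 / σ ^ 2) • (h i).1.ofLp)
    simp_rw [← logLikelihood_eq] at hK
    exact ⟨K, a, hK⟩
  choose K a hK0 hKt hK using hbayes
  have hH : Measurable (randomHistory θ noise π m) :=
    (measurable_history π m).comp (hmodel.measurable_ideal.prodMk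
      (measurable_pi_iff.2 hmodel.measurable_noise))
  have hae := condDistrib_eq_of_lintegral hH hmodel.measurable_ideal hf hK0 hKt hK
    fun F hF => lintegral_ideal_history hσ hmodel π m (F := fun p => F (p.2, p.1))
      (hF.comp measurable_swap)
  filter_upwards [hae] with ω hω
  exact ⟨a (randomHistory θ noise π m ω), hω⟩

end Posterior

/-! ### Precision budget and unit-norm frames -/

section PrecisionBudget

variable {d : ℕ}

lemma trace_eq_sum_of_mulVec_eq {L : Matrix (Fin d) (Fin d) ℝ}
    (v : OrthonormalBasis (Fin d) ℝ (Feature d)) {c : Fin d → ℝ}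
    (h : ∀ i, L *ᵥ (v i).ofLp = c i • (v i).ofLp) : L.trace = ∑ i, c i := by
  have h1 := LinearMap.trace_eq_sum_inner (toLpLin 2 2 L) v
  rw [toLpLin_eq_toLin, trace_toLin_eq, ← toLpLin_eq_toLin] at h1
  rw [h1]
  refine Finset.sum_congr rfl fun i _ => ?_
  have h2 : toLpLin 2 2 L (v i) = c i • v i := by
    ext1; simp [toLpLin_apply, h]
  rw [h2, inner_smul_right, real_inner_self_eq_norm_sq, v.norm_eq_one]
  norm_num

lemma inv_mulVec_eq {L : Matrix (Fin d) (Fin d) ℝ} (hL : L.PosDef) {u : Fin d → ℝ} {c : ℝ}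
    (hc : c ≠ 0) (h : L *ᵥ u = c • u) : L⁻¹ *ᵥ u = c⁻¹ • u := by
  have h1 : L⁻¹ *ᵥ (L *ᵥ u) = u := by
    rw [mulVec_mulVec, nonsing_inv_mul _ (isUnit_iff_ne_zero.2 hL.det_pos.ne'), one_mulVec]
  rw [h, mulVec_smul] at h1
  rw [← h1, smul_smul, inv_mul_cancel₀ hc, one_smul, h1]

/-- Cauchy–Schwarz for the eigenvalues of a positive definite matrix and of its inverse. -/
lemma sq_le_trace_inv_mul_trace {L : Matrix (Fin d) (Fin d) ℝ} (hL : L.PosDef) :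
    (d : ℝ) ^ 2 ≤ L⁻¹.trace * L.trace := by
  have hpos (i : Fin d) := hL.eigenvalues_pos i
  have h (i : Fin d) := hL.isHermitian.mulVec_eigenvectorBasis i
  rw [trace_eq_sum_of_mulVec_eq hL.isHermitian.eigenvectorBasis h,
    trace_eq_sum_of_mulVec_eq hL.isHermitian.eigenvectorBasis
      fun i => inv_mulVec_eq hL (hpos i).ne' (h i)]
  have := Finset.sum_sq_le_sum_mul_sum_of_sq_le_mul (R := ℝ) Finset.univ (r := fun _ : Fin d => 1)
    (fun i _ => (inv_pos.2 (hpos i)).le) (fun i _ => (hpos i).le)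
    (fun i _ => by rw [inv_mul_cancel₀ (hpos i).ne']; norm_num)
  simpa using this

lemma trace_infoMatrix {m : ℕ} {h : History d m} (hh : ∀ i, ‖(h i).1‖ = 1) :
    (infoMatrix h).trace = m := by
  have (i : Fin m) : (h i).1.ofLp ⬝ᵥ (h i).1.ofLp = 1 := by
    rw [← one_pow 2, ← hh i, EuclideanSpace.real_norm_sq_eq]
    simp [dotProduct, sq]
  simp [infoMatrix, trace_sum, trace_vecMulVec, this]

lemma posDef_precision {S₀ : Matrix (Fin d) (Fin d) ℝ} (hS : S₀.PosDef) (σ : ℝ) {m : ℕ}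
    (h : History d m) : (S₀⁻¹ + (1 / σ ^ 2) • infoMatrix h).PosDef :=
  posDef_inv_add hS ((posSemidef_infoMatrix h).smul (by positivity))

lemma trace_precision (S₀ : Matrix (Fin d) (Fin d) ℝ) (σ : ℝ) {m : ℕ} {h : History d m}
    (hh : ∀ i, ‖(h i).1‖ = 1) :
    (S₀⁻¹ + (1 / σ ^ 2) • infoMatrix h).trace = S₀⁻¹.trace + m / σ ^ 2 := by
  rw [trace_add, trace_smul, trace_infoMatrix hh, smul_eq_mul]
  ring

/-- A budget of `m` unit queries bounds the trace of the posterior covariance from below. -/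
lemma le_trace_inv_precision (hd : 1 ≤ d) {S₀ : Matrix (Fin d) (Fin d) ℝ} (hS : S₀.PosDef) (σ : ℝ)
    {m : ℕ} {h : History d m} (hh : ∀ i, ‖(h i).1‖ = 1) :
    (d : ℝ) ^ 2 / (2 * (S₀⁻¹.trace + m / σ ^ 2)) ≤
      (1 / 2) * (S₀⁻¹ + (1 / σ ^ 2) • infoMatrix h)⁻¹.trace := by
  have : Nonempty (Fin d) := ⟨⟨0, hd⟩⟩
  have h1 := sq_le_trace_inv_mul_trace (posDef_precision hS σ h)
  rw [trace_precision S₀ σ hh] at h1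
  have h2 : 0 < S₀⁻¹.trace := hS.inv.trace_pos
  rw [div_le_iff₀ (by positivity)]
  linarith

end PrecisionBudget

section Frames

variable {E : Type*} [NormedAddCommGroup E] [InnerProductSpace ℝ E]

/-- Rotate the pair `(w i, w j)` in its coordinate plane. -/
noncomputable def rotatePair {m : ℕ} (w : Fin m → E) (i j : Fin m) (φ : ℝ) : Fin m → E :=
  Function.update (Function.update w j (-Real.sin φ • w i + Real.cos φ • w j)) i
    (Real.cos φ • w i + Real.sin φ • w j)

lemma rotatePair_fst {m : ℕ} (w : Fin m → E) (i j : Fin m) (φ : ℝ) :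
    rotatePair w i j φ i = Real.cos φ • w i + Real.sin φ • w j := by
  simp [rotatePair]

lemma rotatePair_snd {m : ℕ} (w : Fin m → E) {i j : Fin m} (hij : i ≠ j) (φ : ℝ) :
    rotatePair w i j φ j = -Real.sin φ • w i + Real.cos φ • w j := by
  simp [rotatePair, hij.symm]

lemma rotatePair_of_ne {m : ℕ} (w : Fin m → E) {i j k : Fin m} (hi : k ≠ i) (hj : k ≠ j) (φ : ℝ) :
    rotatePair w i j φ k = w k := by
  simp [rotatePair, hi, hj]

lemma sum_rotatePair {F : Type*} [AddCommGroup F] {m : ℕ} (w : Fin m → E) {i j : Fin m}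
    (hij : i ≠ j) (φ : ℝ) (q : E → F)
    (hq : q (Real.cos φ • w i + Real.sin φ • w j) + q (-Real.sin φ • w i + Real.cos φ • w j) =
      q (w i) + q (w j)) :
    ∑ k, q (rotatePair w i j φ k) = ∑ k, q (w k) := by
  rw [← sub_eq_zero, ← Finset.sum_sub_distrib, Fintype.sum_eq_add i j hij fun k hk => by
    rw [rotatePair_of_ne w hk.1 hk.2, sub_self], rotatePair_fst, rotatePair_snd w hij,
    sub_add_sub_comm, hq, sub_self]

/-- A positive operator of trace `m` that is a sum of `m` rank-one terms is a sum of `m` rank-one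
terms of trace one: rotating a short and a long vector in their plane keeps the operator, and some
rotation makes the first of them a unit vector. -/
theorem exists_unit_frame {m : ℕ} (w : Fin m → E) (hw : ∑ i, ‖w i‖ ^ 2 = m) :
    ∃ y : Fin m → E, (∀ i, ‖y i‖ = 1) ∧
      ∀ x, ∑ i, inner ℝ (y i) x • y i = ∑ i, inner ℝ (w i) x • w i := by
  induction hN : (Finset.univ.filter fun i => ‖w i‖ ^ 2 ≠ 1).card using Nat.strong_induction_on
    generalizing w with
  | _ N ih =>
  by_cases hall : ∀ i, ‖w i‖ ^ 2 = 1
  · exact ⟨w, fun i =>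
      (pow_eq_one_iff_of_nonneg (norm_nonneg _) two_ne_zero).1 (hall i), fun _ => rfl⟩
  push Not at hall
  have hsum : ∑ i, (‖w i‖ ^ 2 - 1) = 0 := by simp [hw]
  have hsum' : ∑ i, (1 - ‖w i‖ ^ 2) = 0 := by simp [hw]
  obtain ⟨i₀, hi₀⟩ := hall
  obtain ⟨j, -, hj⟩ := Finset.exists_pos_of_sum_zero_of_exists_nonzero _ hsum
    ⟨i₀, Finset.mem_univ _, sub_ne_zero.2 hi₀⟩
  obtain ⟨i, -, hi⟩ := Finset.exists_pos_of_sum_zero_of_exists_nonzero _ hsum'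
    ⟨i₀, Finset.mem_univ _, sub_ne_zero.2 (Ne.symm hi₀)⟩
  have hij : i ≠ j := by rintro rfl; linarith
  -- the squared norm of the first rotated vector moves from `‖w i‖ ^ 2 < 1` to `‖w j‖ ^ 2 > 1`
  obtain ⟨φ, -, hφ⟩ : (1 : ℝ) ∈ (fun φ : ℝ => ‖Real.cos φ • w i + Real.sin φ • w j‖ ^ 2) ''
      Set.Icc 0 (Real.pi / 2) := by
    refine intermediate_value_Icc (by positivity) (by fun_prop) ⟨?_, ?_⟩
    · simp only [Real.cos_zero, Real.sin_zero, one_smul, zero_smul, add_zero]; linarith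
    · simp only [Real.cos_pi_div_two, Real.sin_pi_div_two, one_smul, zero_smul, zero_add]; linarith
  have hcs := Real.sin_sq_add_cos_sq φ
  have hnorm : ∑ k, ‖rotatePair w i j φ k‖ ^ 2 = m := by
    rw [sum_rotatePair w hij φ (fun u => ‖u‖ ^ 2), hw]
    simp only [← real_inner_self_eq_norm_sq, inner_add_left, inner_add_right, inner_smul_left,
      inner_smul_right, real_inner_comm (w i) (w j), RCLike.conj_to_real]
    linear_combination (inner ℝ (w i) (w i) + inner ℝ (w j) (w j)) * hcs
  -- the rotated family has fewer non-unit vectors: `i` is unit now, and `j` was not before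
  obtain ⟨y, hy1, hy2⟩ := ih _ (by
    rw [← hN]
    refine Finset.card_lt_card (Finset.ssubset_iff_of_subset ?_ |>.2 ⟨i, ?_, ?_⟩)
    · intro k hk
      rw [Finset.mem_filter_univ] at hk ⊢
      by_cases hki : k = i
      · rw [hki]; linarith
      by_cases hkj : k = j
      · rw [hkj]; linarith
      rwa [rotatePair_of_ne w hki hkj] at hk
    · rw [Finset.mem_filter_univ]; linarith
    · rw [Finset.mem_filter_univ, rotatePair_fst, not_not]; exact hφ) _ hnorm rfl
  refine ⟨y, hy1, fun x => ?_⟩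
  rw [hy2 x, sum_rotatePair w hij φ (fun u => inner ℝ u x • u)]
  simp only [inner_add_left, inner_smul_left, RCLike.conj_to_real]
  linear_combination (norm := module) hcs • (inner ℝ (w i) x • w i + inner ℝ (w j) x • w j)

end Frames

/-! ### Water-filling policies -/

section WaterFillingPolicies

variable {d : ℕ}

lemma mem_spectrum_of_mulVec_eq {S : Matrix (Fin d) (Fin d) ℝ}
    (v : OrthonormalBasis (Fin d) ℝ (Feature d)) {c : ℝ} {i : Fin d}
    (h : S *ᵥ (v i).ofLp = c • (v i).ofLp) : c ∈ spectrum ℝ S := by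
  rw [spectrum.mem_iff]
  intro hu
  have h1 : (algebraMap ℝ (Matrix (Fin d) (Fin d) ℝ) c - S) *ᵥ (v i).ofLp = 0 := by
    rw [sub_mulVec, h, Algebra.algebraMap_eq_smul_one, smul_mulVec, one_mulVec, sub_self]
  have h2 : (v i).ofLp = 0 := by
    apply mulVec_injective_of_isUnit hu
    rw [h1, mulVec_zero]
  have h3 := v.norm_eq_one i
  have h4 : v i = 0 := (ofLp_eq_zero 2).1 h2
  rw [h4, norm_zero] at h3
  norm_num at h3

lemma minEigenvalue_pos (hd : 1 ≤ d) {S : Matrix (Fin d) (Fin d) ℝ} (hS : S.PosDef) :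
    0 < minEigenvalue S := by
  have : Nonempty (Fin d) := ⟨⟨0, hd⟩⟩
  have h := (Set.range_nonempty hS.isHermitian.eigenvalues).csInf_mem (Set.finite_range _)
  rw [minEigenvalue, hS.isHermitian.spectrum_real_eq_range_eigenvalues]
  obtain ⟨i, hi⟩ := h
  rw [← hi]
  exact hS.eigenvalues_pos i

lemma minEigenvalue_le {S : Matrix (Fin d) (Fin d) ℝ} (hS : S.PosDef)
    (v : OrthonormalBasis (Fin d) ℝ (Feature d)) {c : ℝ} {i : Fin d}
    (h : S *ᵥ (v i).ofLp = c • (v i).ofLp) : minEigenvalue S ≤ c := by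
  have hmem := mem_spectrum_of_mulVec_eq v h
  rw [minEigenvalue]
  refine csInf_le ?_ hmem
  rw [hS.isHermitian.spectrum_real_eq_range_eigenvalues]
  exact (Set.finite_range _).bddBelow

lemma div_minEigenvalue_le {S₀ : Matrix (Fin d) (Fin d) ℝ} {σ : ℝ} (hσ : 0 < σ) {m : ℕ}
    (hm : activationThreshold S₀ σ ≤ m) :
    (d : ℝ) / minEigenvalue S₀ ≤ S₀⁻¹.trace + m / σ ^ 2 := by
  have h1 : (d : ℝ) / minEigenvalue S₀ - S₀⁻¹.trace ≤ m / σ ^ 2 := by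
    rw [le_div_iff₀ (by positivity), mul_comm]
    exact (mul_le_mul_of_nonneg_left (le_max_left _ 0) (sq_nonneg σ)).trans hm
  linarith

/-- Beyond the activation threshold the precision budget forces all eigenvalues of a water-filled
posterior covariance to coincide: either all directions are active, or the common level and the
inactive prior eigenvalues are all equal to the smallest prior eigenvalue. -/
theorem trace_inv_precision_of_isWaterFilling (hd : 1 ≤ d) {S₀ : Matrix (Fin d) (Fin d) ℝ}
    (hS : S₀.PosDef) {σ : ℝ} (hσ : 0 < σ) {m : ℕ} (hdm : d ≤ m)
    (hm : activationThreshold S₀ σ ≤ m) {π : Policy d} (hπ : IsWaterFilling S₀ σ m π)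
    (x : Feature d) (e : ℕ → ℝ) :
    (1 / 2) * (S₀⁻¹ + (1 / σ ^ 2) • infoMatrix (history π x e m))⁻¹.trace =
      (d : ℝ) ^ 2 / (2 * (S₀⁻¹.trace + m / σ ^ 2)) := by
  obtain ⟨v, lam, r, level, -, hlam, hr, hlevel, -, -, hthr, hvec⟩ := hπ
  have hd' : (0 : ℝ) < d := by exact_mod_cast hd
  have hmin := minEigenvalue_pos hd hS
  have hlmin (i : Fin d) : minEigenvalue S₀ ≤ lam i := minEigenvalue_le hS v (hlam i)
  have hL := posDef_precision hS σ (history π x e m)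
  set c : Fin d → ℝ := fun i => if i.val < r then level else lam i with hc
  have hcpos (i : Fin d) : 0 < c i := by
    simp only [hc]; split_ifs
    · exact hlevel
    · exact hmin.trans_le (hlmin i)
  have hT : ∑ i, 1 / c i = S₀⁻¹.trace + m / σ ^ 2 := by
    rw [← trace_precision S₀ σ (norm_history_query π x e)]
    exact (trace_eq_sum_of_mulVec_eq v (hvec x e)).symm
  have hinv : (S₀⁻¹ + (1 / σ ^ 2) • infoMatrix (history π x e m))⁻¹.trace = ∑ i, c i := by
    refine trace_eq_sum_of_mulVec_eq v fun i => ?_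
    have := inv_mulVec_eq hL (one_div_ne_zero (hcpos i).ne') (hvec x e i)
    rwa [one_div (c i), inv_inv] at this
  obtain ⟨κ, hκ, hcκ⟩ : ∃ κ : ℝ, 0 < κ ∧ ∀ i, c i = κ := by
    by_cases hrd : r < d
    · refine ⟨minEigenvalue S₀, hmin, ?_⟩
      have hge (i : Fin d) : minEigenvalue S₀ ≤ c i := by
        simp only [hc]; split_ifs
        · exact (hlmin ⟨r, hrd⟩).trans (hthr (by omega) ⟨r, hrd⟩ le_rfl)
        · exact hlmin i
      have hle (i : Fin d) (_ : i ∈ Finset.univ) : 1 / c i ≤ 1 / minEigenvalue S₀ :=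
        one_div_le_one_div_of_le hmin (hge i)
      -- the total precision is at least `d / minEigenvalue S₀`, its largest possible value
      have heq : ∑ i, 1 / c i = ∑ _i : Fin d, 1 / minEigenvalue S₀ := by
        refine le_antisymm (Finset.sum_le_sum hle) ?_
        rw [hT]
        simpa [div_eq_mul_inv] using div_minEigenvalue_le hσ hm
      intro i
      have := (Finset.sum_eq_sum_iff_of_le hle).1 heq i (Finset.mem_univ i)
      rwa [one_div, one_div, _root_.inv_inj] at this
    · exact ⟨level, hlevel, fun i => if_pos (by omega)⟩
  rw [hinv, ← hT]
  simp only [hcκ, Finset.sum_const, Finset.card_univ, Fintype.card_fin, nsmul_eq_mul]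
  field_simp

lemma infoMatrix_mulVec {m : ℕ} (h : History d m) (x : Feature d) :
    infoMatrix h *ᵥ x.ofLp = (∑ i, inner ℝ (h i).1 x • (h i).1).ofLp := by
  simp only [infoMatrix, sum_mulVec, vecMulVec_mulVec, op_smul_eq_smul, ofLp_sum, ofLp_smul]
  refine Finset.sum_congr rfl fun i _ => ?_
  congr 1
  simp [EuclideanSpace.inner_eq_star_dotProduct, dotProduct_comm]

/-- The policy that asks a predetermined sequence of unit queries. -/
def nonadaptive (q : ℕ → Feature d) (hq : ∀ t, ‖q t‖ = 1) : Policy d where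
  query t _ := q t
  measurable_query _ := measurable_const
  norm_query t _ := hq t

lemma history_nonadaptive (q : ℕ → Feature d) (hq : ∀ t, ‖q t‖ = 1) (x : Feature d) (e : ℕ → ℝ)
    {t : ℕ} (i : Fin t) : (history (nonadaptive q hq) x e t i).1 = q i := by
  induction t with
  | zero => exact i.elim0
  | succ t ih =>
    rw [history_succ, extend]
    induction i using Fin.lastCases with
    | last => simp [nonadaptive]
    | cast i => simpa using ih i

lemma exists_antitone_eigenbasis {S : Matrix (Fin d) (Fin d) ℝ} (hS : S.PosDef) :
    ∃ (v : OrthonormalBasis (Fin d) ℝ (Feature d)) (lam : Fin d → ℝ), Antitone lam ∧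
      (∀ i, 0 < lam i) ∧ ∀ i, S *ᵥ (v i).ofLp = lam i • (v i).ofLp := by
  set s := Tuple.sort fun i => -hS.isHermitian.eigenvalues i with hs
  refine ⟨hS.isHermitian.eigenvectorBasis.reindex s.symm, fun i => hS.isHermitian.eigenvalues (s i),
    fun i j hij => ?_, fun i => hS.eigenvalues_pos _, fun i => ?_⟩
  · have := Tuple.monotone_sort (fun i => -hS.isHermitian.eigenvalues i) hij
    exact neg_le_neg_iff.1 this
  · rw [OrthonormalBasis.reindex_apply, Equiv.symm_symm]
    exact hS.isHermitian.mulVec_eigenvectorBasis _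

/-- Every nonnegative spectrum with sum `m ≥ d` is realized by `m` unit queries. -/
lemma exists_unit_queries {m : ℕ} (hdm : d ≤ m) (v : OrthonormalBasis (Fin d) ℝ (Feature d))
    {c : Fin d → ℝ} (hc : ∀ i, 0 ≤ c i) (hsum : ∑ i, c i = m) :
    ∃ y : Fin m → Feature d, (∀ i, ‖y i‖ = 1) ∧
      ∀ i, ∑ t, inner ℝ (y t) (v i) • y t = c i • v i := by
  obtain ⟨n, rfl⟩ := Nat.exists_eq_add_of_le hdm
  obtain ⟨y, hy1, hy2⟩ := exists_unit_frame
    (Fin.append (fun i => Real.sqrt (c i) • v i) (fun _ : Fin n => (0 : Feature d))) (by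
      rw [Fin.sum_univ_add, ← hsum]
      simp [norm_smul, Real.sq_sqrt, hc])
  refine ⟨y, hy1, fun i => ?_⟩
  rw [hy2, Fin.sum_univ_add]
  simp only [Fin.append_left, Fin.append_right, inner_zero_left, zero_smul, Finset.sum_const_zero,
    add_zero, inner_smul_left, RCLike.conj_to_real, v.inner_eq_ite]
  simp [smul_smul, Real.mul_self_sqrt (hc i)]

/-- The directions whose prior eigenvalue exceeds the level form an initial segment. -/
lemma exists_activeRank (lam : Fin d → ℝ) (hlam : Antitone lam) (level : ℝ) :
    ∃ r ≤ d, (∀ i : Fin d, i.val < r → level < lam i) ∧ ∀ i : Fin d, r ≤ i.val → lam i ≤ level := by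
  classical
  have hex : ∃ n, ∀ i : Fin d, n ≤ i.val → lam i ≤ level := ⟨d, fun i hi => by omega⟩
  refine ⟨Nat.find hex, Nat.find_min' hex fun i hi => by omega, fun i hi => ?_, Nat.find_spec hex⟩
  have := Nat.find_min hex hi
  push Not at this
  obtain ⟨j, hij, hj⟩ := this
  exact hj.trans_le (hlam (Fin.le_def.2 hij))

/-- With `m ≥ d` questions past the activation threshold, the level `d / (tr S₀⁻¹ + m / σ ^ 2)` is
at most every prior eigenvalue, so the precision can be raised to a multiple of the identity. -/
theorem exists_isWaterFilling (hd : 1 ≤ d) {S₀ : Matrix (Fin d) (Fin d) ℝ}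
    (hS : S₀.PosDef) {σ : ℝ} (hσ : 0 < σ) {m : ℕ} (hdm : d ≤ m)
    (hm : activationThreshold S₀ σ ≤ m) : ∃ π : Policy d, IsWaterFilling S₀ σ m π := by
  have : Nonempty (Fin d) := ⟨⟨0, hd⟩⟩
  have hd' : (0 : ℝ) < d := by exact_mod_cast hd
  obtain ⟨v, lam, hanti, hpos, hlam⟩ := exists_antitone_eigenbasis hS
  have hmin := minEigenvalue_pos hd hS
  have hinv (i : Fin d) : S₀⁻¹ *ᵥ (v i).ofLp = (lam i)⁻¹ • (v i).ofLp :=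
    inv_mulVec_eq hS (hpos i).ne' (hlam i)
  have htr : S₀⁻¹.trace = ∑ i, (lam i)⁻¹ := trace_eq_sum_of_mulVec_eq v hinv
  have hT0 : 0 < S₀⁻¹.trace + m / σ ^ 2 := by
    have := hS.inv.trace_pos
    positivity
  set level : ℝ := d / (S₀⁻¹.trace + m / σ ^ 2) with hlevel
  have hl0 : 0 < level := by positivity
  have hle (i : Fin d) : level ≤ lam i := by
    refine le_trans ?_ (minEigenvalue_le hS v (hlam i))
    have := div_minEigenvalue_le hσ hm
    rw [div_le_iff₀ hmin] at this
    rw [hlevel, div_le_iff₀ hT0]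
    linarith
  have hbudget : (d : ℝ) / level = S₀⁻¹.trace + m / σ ^ 2 := by
    rw [hlevel]; field_simp
  obtain ⟨r, hrd, hr1, hr2⟩ := exists_activeRank lam hanti level
  -- at the threshold some directions are inactive because their prior eigenvalue is the level
  have hr3 (i : Fin d) (hi : ¬ i.val < r) : lam i = level := le_antisymm (hr2 i (by omega)) (hle i)
  -- the information that lifts the precision in direction `v i` from `(lam i)⁻¹` to `level⁻¹`
  obtain ⟨y, hy1, hy2⟩ := exists_unit_queries hdm v (c := fun i => σ ^ 2 * (level⁻¹ - (lam i)⁻¹))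
    (fun i => mul_nonneg (sq_nonneg σ) (sub_nonneg.2 (inv_anti₀ hl0 (hle i)))) (by
      rw [← Finset.mul_sum, Finset.sum_sub_distrib, ← htr]
      simp only [Finset.sum_const, Finset.card_univ, Fintype.card_fin, nsmul_eq_mul]
      rw [← div_eq_mul_inv, hbudget]
      field_simp
      ring)
  refine ⟨nonadaptive (fun t => if h : t < m then y ⟨t, h⟩ else v ⟨0, hd⟩) fun t => ?_, v, lam, r,
    level, hanti, hlam, by omega, hl0, ?_, hr1, fun _ => hr2, fun x e i => ?_⟩
  · split_ifs
    · exact hy1 _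
    · exact v.norm_eq_one _
  · have hsplit := Finset.sum_filter_add_sum_filter_not Finset.univ (fun i : Fin d => i.val < r)
      fun i => (lam i)⁻¹
    have hinactive : ∑ i : Fin d with ¬ i.val < r, (lam i)⁻¹ = (d - r) / level := by
      rw [Finset.sum_congr rfl fun i hi => by rw [hr3 i (Finset.mem_filter.1 hi).2],
        Finset.sum_const, Finset.filter_not, Finset.card_sdiff_of_subset (Finset.filter_subset _ _),
        Fin.card_filter_val_lt, Finset.card_univ, Fintype.card_fin, min_eq_right hrd, nsmul_eq_mul,
        Nat.cast_sub hrd, div_eq_mul_inv]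
    rw [hinactive, ← htr] at hsplit
    simp only [one_div]
    rw [sub_div] at hsplit
    linarith
  · have hc : (if i.val < r then level else lam i) = level := by
      split_ifs with h
      · rfl
      · exact hr3 i h
    rw [hc, add_mulVec, hinv, smul_mulVec, infoMatrix_mulVec]
    simp only [history_nonadaptive, Fin.is_lt, dite_true, Fin.eta]
    rw [hy2, ofLp_smul, smul_smul, ← add_smul]
    congr 1
    field_simp
    ring

end WaterFillingPolicies

/-! ### Numbers of questions and products -/

section Requirements

variable {Ω : Type*} [MeasurableSpace Ω] {P : Measure Ω} [IsProbabilityMeasure P] {d : ℕ}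
  {μ₀ : Feature d} {S₀ : Matrix (Fin d) (Fin d) ℝ} {σ : ℝ} {θ : Ω → Feature d}
  {noise : ℕ → Ω → ℝ}

/-- The limit value is `0` and the gap is half the trace of the inverse of the precision that the
queries have produced. -/
theorem posteriorAt_value (hd : 1 ≤ d) (hS : S₀.PosDef) (hσ : 0 < σ)
    (hmodel : IsGaussianModel μ₀ S₀ σ P θ noise) (π : Policy d) (m : ℕ) :
    ∀ᵐ ω ∂P,
      Tendsto (fun k : ℕ => optimalValue (posteriorAt P θ noise π m ω) k) atTop (𝓝 0) ∧
      limitValue (posteriorAt P θ noise π m ω) = 0 ∧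
      optimalValue (posteriorAt P θ noise π m ω) 1 =
        -(1 / 2) * (covMatrix (posteriorAt P θ noise π m ω)).trace ∧
      covMatrix (posteriorAt P θ noise π m ω) =
        (S₀⁻¹ + (1 / σ ^ 2) • infoMatrix (randomHistory θ noise π m ω))⁻¹ := by
  filter_upwards [posteriorAt_eq_multivariateGaussian hS hσ hmodel π m] with ω ⟨a, ha⟩
  rw [ha]
  exact ⟨tendsto_optimalValue hd IsGaussian.memLp_two_id,
    limitValue_eq_zero hd IsGaussian.memLp_two_id, optimalValue_one IsGaussian.memLp_two_id,
    covMatrix_multivariateGaussian (posDef_precision hS σ _).inv.posSemidef a⟩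

lemma le_gap (hd : 1 ≤ d) (hS : S₀.PosDef) (hσ : 0 < σ)
    (hmodel : IsGaussianModel μ₀ S₀ σ P θ noise) (π : Policy d) (m : ℕ) :
    ∀ᵐ ω ∂P, (d : ℝ) ^ 2 / (2 * (S₀⁻¹.trace + (m : ℝ) / σ ^ 2)) ≤
      limitValue (posteriorAt P θ noise π m ω) - optimalValue (posteriorAt P θ noise π m ω) 1 := by
  filter_upwards [posteriorAt_value hd hS hσ hmodel π m] with ω ⟨_, h0, h1, hcov⟩
  rw [h0, h1, hcov]
  have := le_trace_inv_precision hd hS σ (h := randomHistory θ noise π m ω)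
    (norm_history_query π _ _)
  linarith

lemma gap_eq_of_isWaterFilling (hd : 1 ≤ d) (hS : S₀.PosDef) (hσ : 0 < σ)
    (hmodel : IsGaussianModel μ₀ S₀ σ P θ noise) {m : ℕ} (hdm : d ≤ m)
    (hm : activationThreshold S₀ σ ≤ m) {π : Policy d} (hπ : IsWaterFilling S₀ σ m π) :
    ∀ᵐ ω ∂P, limitValue (posteriorAt P θ noise π m ω) -
      optimalValue (posteriorAt P θ noise π m ω) 1 =
        (d : ℝ) ^ 2 / (2 * (S₀⁻¹.trace + (m : ℝ) / σ ^ 2)) := by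
  filter_upwards [posteriorAt_value hd hS hσ hmodel π m] with ω ⟨_, h0, h1, hcov⟩
  rw [h0, h1, hcov, ← trace_inv_precision_of_isWaterFilling hd hS hσ hdm hm hπ (θ ω)
    (fun t => noise t ω)]
  simp only [randomHistory]
  ring

lemma le_questions_of_gap_le (hd : 1 ≤ d) (hS : S₀.PosDef) (hσ : 0 < σ)
    (hmodel : IsGaussianModel μ₀ S₀ σ P θ noise) {δ : ℝ} (hδ : 0 < δ) (π : Policy d) (m : ℕ) :
    ∀ᵐ ω ∂P, limitValue (posteriorAt P θ noise π m ω) -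
      optimalValue (posteriorAt P θ noise π m ω) 1 ≤ δ →
        σ ^ 2 * max ((d : ℝ) ^ 2 / (2 * δ) - S₀⁻¹.trace) 0 ≤ (m : ℝ) := by
  have : Nonempty (Fin d) := ⟨⟨0, hd⟩⟩
  have hT : 0 < S₀⁻¹.trace + (m : ℝ) / σ ^ 2 := by
    have := hS.inv.trace_pos
    positivity
  filter_upwards [le_gap hd hS hσ hmodel π m] with ω hω hgap
  have h1 := hω.trans hgap
  rw [div_le_iff₀ (by positivity)] at h1
  have h2 : (d : ℝ) ^ 2 / (2 * δ) - S₀⁻¹.trace ≤ m / σ ^ 2 := by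
    rw [sub_le_iff_le_add, div_le_iff₀ (by positivity)]
    linarith
  have h3 := max_le h2 (by positivity)
  rw [le_div_iff₀ (by positivity)] at h3
  linarith

/-- Beyond the activation threshold, `d² σ² / (2 δ)` water-filling questions suffice. -/
lemma questionsNeeded_isWaterFilling_le (hd : 1 ≤ d) (hS : S₀.PosDef) (hσ : 0 < σ)
    (hmodel : IsGaussianModel μ₀ S₀ σ P θ noise) {δ : ℝ} (hδ : 0 < δ) {m : ℕ} (hdm : d ≤ m)
    (hm : activationThreshold S₀ σ ≤ m) (hmδ : (d : ℝ) ^ 2 * σ ^ 2 / (2 * δ) ≤ m) :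
    questionsNeeded P θ noise (fun _ _ => True) δ ≤
        questionsNeeded P θ noise (IsWaterFilling S₀ σ) δ ∧
      questionsNeeded P θ noise (IsWaterFilling S₀ σ) δ ≤ m ∧
      σ ^ 2 * max ((d : ℝ) ^ 2 / (2 * δ) - S₀⁻¹.trace) 0 ≤
        questionsNeeded P θ noise (fun _ _ => True) δ := by
  have : Nonempty (Fin d) := ⟨⟨0, hd⟩⟩
  have hT := hS.inv.trace_pos
  obtain ⟨π, hπ⟩ := exists_isWaterFilling hd hS hσ hdm hm
  have hmem : m ∈ {m : ℕ | ∃ π : Policy d, IsWaterFilling S₀ σ m π ∧ ∀ᵐ ω ∂P,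
      limitValue (posteriorAt P θ noise π m ω) -
        optimalValue (posteriorAt P θ noise π m ω) 1 ≤ δ} := by
    refine ⟨π, hπ, ?_⟩
    filter_upwards [gap_eq_of_isWaterFilling hd hS hσ hmodel hdm hm hπ] with ω hω
    rw [hω, div_le_iff₀ (by positivity)]
    rw [div_le_iff₀ (by positivity)] at hmδ
    have h1 : (d : ℝ) ^ 2 ≤ 2 * δ * (m / σ ^ 2) := by
      rw [mul_div_assoc', le_div_iff₀ (by positivity)]
      linarith
    nlinarith [mul_pos hδ hT]
  obtain ⟨π', hπ', hgap'⟩ := Nat.sInf_mem ⟨m, hmem⟩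
  refine ⟨Nat.sInf_le ⟨π', trivial, hgap'⟩, Nat.sInf_le hmem, ?_⟩
  obtain ⟨π'', -, hgap''⟩ := Nat.sInf_mem
    (s := {m : ℕ | ∃ π : Policy d, True ∧ ∀ᵐ ω ∂P, limitValue (posteriorAt P θ noise π m ω) -
      optimalValue (posteriorAt P θ noise π m ω) 1 ≤ δ}) ⟨_, π', trivial, hgap'⟩
  obtain ⟨ω, h1, h2⟩ := (hgap''.and (le_questions_of_gap_le hd hS hσ hmodel hδ π'' _)).exists
  exact h2 h1

lemma eventually_questionsNeeded (hd : 1 ≤ d) (hS : S₀.PosDef) (hσ : 0 < σ)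
    (hmodel : IsGaussianModel μ₀ S₀ σ P θ noise) :
    ∀ᶠ δ : ℝ in 𝓝[>] 0,
      (1 / 4) * ((d : ℝ) ^ 2 * σ ^ 2 / δ) ≤
          (questionsNeeded P θ noise (fun _ _ => True) δ : ℝ) ∧
        questionsNeeded P θ noise (fun _ _ => True) δ ≤
          questionsNeeded P θ noise (IsWaterFilling S₀ σ) δ ∧
        (questionsNeeded P θ noise (IsWaterFilling S₀ σ) δ : ℝ) ≤
          (d : ℝ) ^ 2 * σ ^ 2 / δ := by
  have hd' : (0 : ℝ) < d := by exact_mod_cast hd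
  have hlim : Tendsto (fun δ : ℝ => (d : ℝ) ^ 2 * σ ^ 2 / δ) (𝓝[>] 0) atTop := by
    simp_rw [div_eq_mul_inv]
    exact tendsto_inv_nhdsGT_zero.const_mul_atTop (by positivity)
  filter_upwards [self_mem_nhdsWithin, hlim.eventually_ge_atTop 2,
    hlim.eventually_ge_atTop ((d : ℝ) + 1),
    hlim.eventually_ge_atTop (activationThreshold S₀ σ + 1),
    hlim.eventually_ge_atTop (4 * (σ ^ 2 * S₀⁻¹.trace))] with δ hδ h2 hXd hXm hXT
  have hδ : 0 < δ := hδ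
  -- `⌊X⌋₊` questions suffice: `X - 1` is past the thresholds, and `X - 1 ≥ X / 2`
  set X := (d : ℝ) ^ 2 * σ ^ 2 / δ with hX
  have hfl : X < ⌊X⌋₊ + 1 := Nat.lt_floor_add_one X
  have hfl' : (⌊X⌋₊ : ℝ) ≤ X := Nat.floor_le (by positivity)
  have hhalf : (d : ℝ) ^ 2 * σ ^ 2 / (2 * δ) = X / 2 := by rw [hX]; field_simp
  obtain ⟨h3, h4, h5⟩ := questionsNeeded_isWaterFilling_le hd hS hσ hmodel hδ (m := ⌊X⌋₊)
    (Nat.le_floor (by linarith)) (by linarith) (by rw [hhalf]; linarith)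
  refine ⟨le_trans ?_ h5, h3, le_trans (by exact_mod_cast h4) hfl'⟩
  calc (1 / 4) * X ≤ X / 2 - σ ^ 2 * S₀⁻¹.trace := by linarith
    _ = σ ^ 2 * ((d : ℝ) ^ 2 / (2 * δ) - S₀⁻¹.trace) := by rw [← hhalf]; ring
    _ ≤ _ := mul_le_mul_of_nonneg_left (le_max_left _ _) (sq_nonneg σ)

lemma isTheta_of_sandwich {α : Type*} {l : Filter α} {f g : α → ℝ} {c : ℝ} (hc : 0 < c)
    (h : ∀ᶠ a in l, 0 ≤ f a ∧ 0 ≤ g a ∧ c * g a ≤ f a ∧ f a ≤ g a) : f =Θ[l] g := by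
  constructor
  · refine IsBigO.of_bound 1 (h.mono fun a ⟨hf, hg, _, h2⟩ => ?_)
    rwa [Real.norm_of_nonneg hf, Real.norm_of_nonneg hg, one_mul]
  · refine IsBigO.of_bound c⁻¹ (h.mono fun a ⟨hf, hg, h1, _⟩ => ?_)
    rwa [Real.norm_of_nonneg hf, Real.norm_of_nonneg hg, ← div_eq_inv_mul, le_div_iff₀' hc]

/-- Without questions the belief is the prior. The transcript type has one element, so the
posterior is the same measure for every realization. -/
lemma exists_posteriorAt_zero_eq (hS : S₀.PosDef) (hσ : 0 < σ)
    (hmodel : IsGaussianModel μ₀ S₀ σ P θ noise) (π : Policy d) :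
    ∃ a : Feature d, ∀ ω, posteriorAt P θ noise π 0 ω = multivariateGaussian a S₀ := by
  obtain ⟨ω₀, a, ha⟩ := (posteriorAt_eq_multivariateGaussian hS hσ hmodel π 0).exists
  refine ⟨a, fun ω => ?_⟩
  have hsub : posteriorAt P θ noise π 0 ω = posteriorAt P θ noise π 0 ω₀ := by
    simp only [posteriorAt]
    rw [Subsingleton.elim (randomHistory θ noise π 0 ω) (randomHistory θ noise π 0 ω₀)]
  rw [hsub, ha, infoMatrix, Finset.univ_eq_empty, Finset.sum_empty, smul_zero, add_zero,
    nonsing_inv_nonsing_inv _ (isUnit_iff_ne_zero.2 hS.det_pos.ne')]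

lemma le_productsNeeded (hd : 1 ≤ d) (hS : S₀.PosDef) (hσ : 0 < σ)
    (hmodel : IsGaussianModel μ₀ S₀ σ P θ noise) (π : Policy d) {δ : ℝ} (hδ : 0 < δ) :
    ((d : ℝ) * S₀.det ^ (1 / (d : ℝ)) / (2 * δ)) ^ ((d : ℝ) / 2) ≤
      productsNeeded P θ noise π δ := by
  obtain ⟨a, ha⟩ := exists_posteriorAt_zero_eq hS hσ hmodel π
  have h0 : limitValue (multivariateGaussian a S₀) = 0 :=
    limitValue_eq_zero hd IsGaussian.memLp_two_id
  have hne : {k : ℕ | 1 ≤ k ∧ ∀ᵐ ω ∂P, limitValue (posteriorAt P θ noise π 0 ω) -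
      optimalValue (posteriorAt P θ noise π 0 ω) k ≤ δ}.Nonempty := by
    have hlim := tendsto_optimalValue (ν := multivariateGaussian a S₀) hd IsGaussian.memLp_two_id
    obtain ⟨k, hk, hk1⟩ := ((hlim.eventually (lt_mem_nhds (neg_neg_of_pos hδ))).and
      (eventually_ge_atTop 1)).exists
    refine ⟨k, hk1, ae_of_all _ fun ω => ?_⟩
    rw [ha, h0]
    linarith
  obtain ⟨hk, hgap⟩ := Nat.sInf_mem hne
  obtain ⟨ω, hω⟩ := hgap.exists
  rw [ha, h0, zero_sub] at hω
  exact le_card_of_gap_le hd hS a hk hδ hω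

end Requirements

end SolicitThenSuggest

theorem proposition6 {Ω : Type*} [MeasurableSpace Ω] (P : Measure Ω) [IsProbabilityMeasure P]
    (d : ℕ) (hd : 1 ≤ d) (μ₀ : Feature d) (S₀ : Matrix (Fin d) (Fin d) ℝ) (hS : S₀.PosDef)
    (σ : ℝ) (hσ : 0 < σ) (θ : Ω → Feature d) (noise : ℕ → Ω → ℝ)
    (hmodel : IsGaussianModel μ₀ S₀ σ P θ noise) :
    -- (i) under every policy: the limit `V_∞^*` exists, the hedging gap is `½ tr S_m`,
    -- and it obeys the lower bound
    (∀ (π : Policy d) (m : ℕ), ∀ᵐ ω ∂P,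
      Tendsto (fun k : ℕ => optimalValue (posteriorAt P θ noise π m ω) k) atTop
        (𝓝 (limitValue (posteriorAt P θ noise π m ω))) ∧
      limitValue (posteriorAt P θ noise π m ω) - optimalValue (posteriorAt P θ noise π m ω) 1 =
        (1 / 2) * (covMatrix (posteriorAt P θ noise π m ω)).trace ∧
      (d : ℝ) ^ 2 / (2 * (S₀⁻¹.trace + (m : ℝ) / σ ^ 2)) ≤
        limitValue (posteriorAt P θ noise π m ω) -
          optimalValue (posteriorAt P θ noise π m ω) 1) ∧
    -- (i) rank-capped water-filling exists and attains the bound once `m ≥ max {d, m̄}`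
    (∀ m : ℕ, max (d : ℝ) (activationThreshold S₀ σ) ≤ (m : ℝ) →
      (∃ π : Policy d, IsWaterFilling S₀ σ m π) ∧
      ∀ π : Policy d, IsWaterFilling S₀ σ m π → ∀ᵐ ω ∂P,
        limitValue (posteriorAt P θ noise π m ω) -
            optimalValue (posteriorAt P θ noise π m ω) 1 =
          (d : ℝ) ^ 2 / (2 * (S₀⁻¹.trace + (m : ℝ) / σ ^ 2))) ∧
    -- (ii) number of questions that any policy needs for a gap of at most `δ`
    (∀ δ : ℝ, 0 < δ → ∀ (π : Policy d) (m : ℕ), ∀ᵐ ω ∂P,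
      limitValue (posteriorAt P θ noise π m ω) -
          optimalValue (posteriorAt P θ noise π m ω) 1 ≤ δ →
        σ ^ 2 * max ((d : ℝ) ^ 2 / (2 * δ) - S₀⁻¹.trace) 0 ≤ (m : ℝ)) ∧
    -- (ii) the minimal number of questions, over all policies and with water-filling,
    -- is `Θ(d² σ² / δ)` as `δ ↓ 0`, with constants that do not depend on the model
    ((fun δ : ℝ => (questionsNeeded P θ noise (fun _ _ => True) δ : ℝ))
        =Θ[𝓝[>] 0] fun δ : ℝ => (d : ℝ) ^ 2 * σ ^ 2 / δ) ∧
    ((fun δ : ℝ => (questionsNeeded P θ noise (IsWaterFilling S₀ σ) δ : ℝ))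
        =Θ[𝓝[>] 0] fun δ : ℝ => (d : ℝ) ^ 2 * σ ^ 2 / δ) ∧
    (∀ᶠ δ : ℝ in 𝓝[>] 0,
      (1 / 4) * ((d : ℝ) ^ 2 * σ ^ 2 / δ) ≤
          (questionsNeeded P θ noise (fun _ _ => True) δ : ℝ) ∧
        questionsNeeded P θ noise (fun _ _ => True) δ ≤
          questionsNeeded P θ noise (IsWaterFilling S₀ σ) δ ∧
        (questionsNeeded P θ noise (IsWaterFilling S₀ σ) δ : ℝ) ≤
          (d : ℝ) ^ 2 * σ ^ 2 / δ) ∧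
    -- (ii) number of products needed without solicitation
    (∀ π : Policy d,
      (∀ δ : ℝ, 0 < δ → ∀ k : ℕ, 1 ≤ k → ∀ᵐ ω ∂P,
        limitValue (posteriorAt P θ noise π 0 ω) -
            optimalValue (posteriorAt P θ noise π 0 ω) k ≤ δ →
          ((d : ℝ) * S₀.det ^ (1 / (d : ℝ)) / (2 * δ)) ^ ((d : ℝ) / 2) ≤ (k : ℝ)) ∧
      ((fun δ : ℝ => δ ^ (-((d : ℝ) / 2)))
        =O[𝓝[>] 0] fun δ : ℝ => (productsNeeded P θ noise π δ : ℝ))) := by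
  have hquestions := eventually_questionsNeeded hd hS hσ hmodel
  refine ⟨fun π m => ?_, fun m hm => ?_, fun δ hδ π m => ?_, ?_, ?_, hquestions, fun π => ⟨?_, ?_⟩⟩
  · filter_upwards [posteriorAt_value hd hS hσ hmodel π m, le_gap hd hS hσ hmodel π m]
      with ω ⟨hlim, h0, h1, _⟩ hgap
    refine ⟨h0.symm ▸ hlim, ?_, hgap⟩
    rw [h0, h1]
    ring
  · have hdm : d ≤ m := by exact_mod_cast (le_max_left _ _).trans hm
    have hm' := (le_max_right _ _).trans hm
    exact ⟨exists_isWaterFilling hd hS hσ hdm hm',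
      fun π hπ => gap_eq_of_isWaterFilling hd hS hσ hmodel hdm hm' hπ⟩
  · exact le_questions_of_gap_le hd hS hσ hmodel hδ π m
  · refine isTheta_of_sandwich (c := 1 / 4) (by norm_num) ?_
    filter_upwards [hquestions, self_mem_nhdsWithin] with δ ⟨h1, h2, h3⟩ hδ
    have hδ : 0 < δ := hδ
    exact ⟨Nat.cast_nonneg _, by positivity, h1, le_trans (by exact_mod_cast h2) h3⟩
  · refine isTheta_of_sandwich (c := 1 / 4) (by norm_num) ?_
    filter_upwards [hquestions, self_mem_nhdsWithin] with δ ⟨h1, h2, h3⟩ hδ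
    have hδ : 0 < δ := hδ
    exact ⟨Nat.cast_nonneg _, by positivity, h1.trans (by exact_mod_cast h2), h3⟩
  · intro δ hδ k hk
    obtain ⟨a, ha⟩ := exists_posteriorAt_zero_eq hS hσ hmodel π
    refine ae_of_all _ fun ω hω => ?_
    rw [ha, limitValue_eq_zero hd IsGaussian.memLp_two_id, zero_sub] at hω
    exact le_card_of_gap_le hd hS a hk hδ hω
  · have hd' : (0 : ℝ) < d := by exact_mod_cast hd
    have hdet := hS.det_pos
    set A : ℝ := (d : ℝ) * S₀.det ^ (1 / (d : ℝ)) / 2 with hA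
    have hA0 : 0 < A := by positivity
    refine IsBigO.of_bound (A ^ ((d : ℝ) / 2))⁻¹ ?_
    filter_upwards [self_mem_nhdsWithin] with δ hδ
    have hδ : 0 < δ := hδ
    have h := le_productsNeeded hd hS hσ hmodel π hδ
    rw [← div_div, ← hA, Real.div_rpow hA0.le hδ.le, div_eq_mul_inv,
      ← Real.rpow_neg hδ.le] at h
    rw [Real.norm_of_nonneg (by positivity), Real.norm_of_nonneg (Nat.cast_nonneg _),
      ← div_eq_inv_mul, le_div_iff₀' (by positivity)]
    exact h
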